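/- Let $G=(V,E)$ be a finite connected simple undirected graph with edge weights $W_{ij}=W_{ji}>0$ for $\{i,j\}\in E$, and let $i_0\in V$. Let $\mathcal T$ be the set of spanning trees of $G$ (as sets of undirected edges), $\vec E=\{(i,j):\{i,j\}\in E\}$, $\Omega_{i_0}=\{u\in\mathbb R^V:u_{i_0}=0\}$, and let $\mathcal H\subseteq\mathbb R^{\vec E}$ be the space of all $\kappa$ with $\sum_{j:\{i,j\}\in E}(\kappa_{ij}-\kappa_{ji})=0$ for all $i\in V$. Let $\vec T_0\subset\vec E$ be any directed reference spanning tree of $G$ (it contains exactly one orientation of each edge of some spanning tree, and nothing else). The restriction map $\iota:\mathcal H\to\mathbb R^{\vec E\setminus\vec T_0}$ is an isomorphism; let $d\kappa_{\mathcal H}$ be the image of Lebesgue measure on $\mathbb R^{\vec E\setminus\vec T_0}$ under $\iota^{-1}$. Put $\omega'_{ij}=\tfrac12W_{ij}e^{u_i+u_j}$ and $$B(s,u)=\exp\Big(\sum_{\{i,j\}\in E}W_{ij}\big(1-\cosh(u_i-u_j)-\tfrac12e^{u_i+u_j}(s_i-s_j)^2\big)\Big).$$ On $\Omega_{i_0}^2\times\mathcal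 T$ define the tree version of the $H^{2|2}$ model $$\mu^{\mathrm{susy}}_{i_0}(ds\,du\,dT')=B(s,u)\prod_{\{i,j\}\in T'}W_{ij}e^{u_i+u_j}\prod_{i\in V\setminus\{i_0\}}\frac{e^{-u_i}\,ds_i\,du_i}{2\pi}\cdot dT'.$$ On $\mathcal H^2\times\Omega_{i_0}^3\times V^2\times\mathcal T^2$, with variables $(\kappa,\kappa',s,v,u,i_1,i_1',T,T')$, define $$\mu^{\mathrm{big}}_{i_0}=\rho^{\mathrm{big}}_{i_0}\,d\kappa_{\mathcal H}\,d\kappa'_{\mathcal H}\prod_{i\in V\setminus\{i_0\}}1_{\{u_i=v_i\}}\,ds_i\,du_i\cdot di_1\,di_1'\,dT\,dT',$$ $$\rho^{\mathrm{big}}_{i_0}=\frac{4^{|V|-1}}{(2\pi)^{2|E|}}\,B(s,u)\prod_{\{i,j\}\in T}\omega'_{ij}\prod_{\{i,j\}\in T'}\omega'_{ij}\prod_{\{i,j\}\in E}\frac1{(\omega'_{ij})^2}\,\exp\Big(-\sum_{(i,j)\in\vec E}\frac{\kappa_{ij}^2+(\kappa'_{ij})^2}{2\omega'_{ij}}\Big)\frac{e^{2v_{i_1}+2u_{i_1'}}}{\sum_{i\in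 V}e^{2v_i}\sum_{j\in V}e^{2u_j}}\prod_{i\in V\setminus\{i_0\}}e^{-u_i}.$$ Here $ds_i,du_i$ are Lebesgue measures on $\mathbb R$; $di_1,di_1'$ and $dT,dT'$ are counting measures on $V$ and $\mathcal T$; and $\prod_{i\ne i_0}1_{\{u_i=v_i\}}du_i$ is the image of $\prod_{i\neq i_0}du_i$ under $u\mapsto(v,u)=(u,u)$. Then the following hold. 1. The marginal of $(s,u,i_1,i_1',T,T')$ under $\mu^{\mathrm{big}}_{i_0}$ equals $$\frac1{\pi^{|V|-1}}\,B(s,u)\prod_{\{i,j\}\in T'}\omega'_{ij}\cdot\frac{\prod_{\{i,j\}\in T}\omega'_{ij}}{\sum_{S\in\mathcal T}\prod_{\{i,j\}\in S}\omega'_{ij}}\cdot\frac{e^{2u_{i_1}+2u_{i_1'}}}{\big(\sum_{j\in V}e^{2u_j}\big)^2}\prod_{i\in V\setminus\{i_0\}}e^{-u_i}\,ds_i\,du_i\cdot di_1\,di_1'\,dT\,dT'.$$ 2. The marginal of $(s,u,T')$ under $\mu^{\mathrm{big}}_{i_0}$ equals $\mu^{\mathrm{susy}}_{i_0}$. 3.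 $\mu^{\mathrm{big}}_{i_0}$ is a probability measure. -/

import Mathlib

open MeasureTheory
open scoped BigOperators ENNReal

namespace ExtendedH22

noncomputable section

variable {V : Type*} [Fintype V] [DecidableEq V]

/-! ### Graph data -/

/-- A set `T` of undirected edges is (the edge set of) a spanning tree of `G`. -/
def IsSpanningTree (G : SimpleGraph V) (T : Finset (Sym2 V)) : Prop :=
  (T : Set (Sym2 V)) ⊆ G.edgeSet ∧ (SimpleGraph.fromEdgeSet (T : Set (Sym2 V))).IsTree

/-- The set `𝒯` of undirected spanning trees of `G`, each viewed as a set of undirected edges. -/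
def SpanningTree (G : SimpleGraph V) : Type _ :=
  {T : Finset (Sym2 V) // IsSpanningTree G T}

namespace SpanningTree

variable {G : SimpleGraph V}

/-- The edges of a spanning tree. -/
def edges (T : SpanningTree G) : Finset (Sym2 V) := T.1

instance : Finite (SpanningTree G) :=
  inferInstanceAs (Finite {T : Finset (Sym2 V) // IsSpanningTree G T})

instance : Fintype (SpanningTree G) := Fintype.ofFinite _

/-- All sets of spanning trees are measurable. -/
instance : MeasurableSpace (SpanningTree G) := ⊤

end SpanningTree

/-- A directed spanning tree: a set of directed edges of `G` that contains exactly one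
orientation of every edge of some spanning tree, and nothing else. -/
structure DirectedSpanningTree (G : SimpleGraph V) where
  /-- The directed edges of the tree. -/
  darts : Finset G.Dart
  /-- No edge is contained with both orientations. -/
  injOn : Set.InjOn SimpleGraph.Dart.edge (darts : Set G.Dart)
  /-- The underlying undirected edges form a spanning tree. -/
  isSpanningTree : IsSpanningTree G (darts.image SimpleGraph.Dart.edge)

/-! ### Sourceless currents and their Lebesgue measure -/

section Currents

variable (G : SimpleGraph V) [DecidableRel G.Adj]

/-- The net outflow `∑_j (κ_ij - κ_ji)` of a current `κ` on the directed edges, at each vertex `i`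
(the sum runs over the directed edges that start in `i`). -/
def netOutflow : (G.Dart → ℝ) →ₗ[ℝ] (V → ℝ) where
  toFun κ i := ∑ d : G.Dart with d.fst = i, (κ d - κ d.symm)
  map_add' κ κ' := by
    funext i
    simp only [Pi.add_apply, ← Finset.sum_add_distrib]
    exact Finset.sum_congr rfl fun d _ => by ring
  map_smul' c κ := by
    funext i
    simp only [Pi.smul_apply, smul_eq_mul, RingHom.id_apply, Finset.mul_sum]
    exact Finset.sum_congr rfl fun d _ => by ring

/-- The space `ℋ` of sourceless currents: the homogeneous Kirchhoff rules hold at all vertices. -/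
def Currents : Submodule ℝ (G.Dart → ℝ) := LinearMap.ker (netOutflow G)

variable {G}

/-- The restriction `ι` of currents in `ℋ` to the directed edges outside a directed
spanning tree. -/
def restrict (T₀ : DirectedSpanningTree G) :
    Currents G →ₗ[ℝ] ({d : G.Dart // d ∉ T₀.darts} → ℝ) where
  toFun κ d := (κ : G.Dart → ℝ) d
  map_add' _ _ := rfl
  map_smul' _ _ := rfl

theorem sum_netOutflow_eq (κ : G.Dart → ℝ) (A : Finset V) :
    ∑ i ∈ A, netOutflow G κ i =
      ∑ d : G.Dart with d.fst ∈ A ∧ d.snd ∉ A, (κ d - κ d.symm) := by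
  have h1 : ∑ i ∈ A, netOutflow G κ i = ∑ d : G.Dart with d.fst ∈ A, (κ d - κ d.symm) := by
    simp only [netOutflow, LinearMap.coe_mk, AddHom.coe_mk, Finset.sum_filter]
    rw [Finset.sum_comm]
    refine Finset.sum_congr rfl fun d _ => ?_
    rw [Finset.sum_ite_eq]
  have h2 : ∑ d : G.Dart with d.fst ∈ A ∧ d.snd ∈ A, (κ d - κ d.symm) = 0 := by
    have hs : ∑ d : G.Dart with d.fst ∈ A ∧ d.snd ∈ A, κ d.symm =
        ∑ d : G.Dart with d.fst ∈ A ∧ d.snd ∈ A, κ d := by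
      refine Finset.sum_nbij' (fun d => d.symm) (fun d => d.symm) ?_ ?_ ?_ ?_ ?_ <;>
        simp +contextual
    rw [Finset.sum_sub_distrib, hs, sub_self]
  rw [h1, ← Finset.sum_filter_add_sum_filter_not _ (fun d : G.Dart => d.snd ∈ A),
    Finset.filter_filter, Finset.filter_filter, h2, zero_add]

theorem restrict_injective (T₀ : DirectedSpanningTree G) : Function.Injective (restrict T₀) := by
  classical
  rw [← LinearMap.ker_eq_bot, LinearMap.ker_eq_bot']
  rintro ⟨κ, hκ⟩ h0
  have hout : ∀ d : G.Dart, d ∉ T₀.darts → κ d = 0 := fun d hd => congrFun h0 ⟨d, hd⟩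
  refine Subtype.ext (funext fun d => ?_)
  by_cases hd : d ∉ T₀.darts
  · exact hout d hd
  push Not at hd
  show κ d = 0
  -- the cut obtained by removing the edge of `d` from the tree
  set F := SimpleGraph.fromEdgeSet ((T₀.darts.image SimpleGraph.Dart.edge : Finset (Sym2 V)) :
    Set (Sym2 V)) with hF
  have hacyc : F.IsAcyclic := T₀.isSpanningTree.2.isAcyclic
  have hadj : ∀ e ∈ T₀.darts, F.Adj e.fst e.snd := fun e he => by
    rw [hF, SimpleGraph.fromEdgeSet_adj]
    exact ⟨Finset.mem_coe.2 (Finset.mem_image.2 ⟨e, he, rfl⟩), e.adj.ne⟩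
  have hbr : F.IsBridge s(d.fst, d.snd) :=
    SimpleGraph.isAcyclic_iff_forall_adj_isBridge.1 hacyc (hadj d hd)
  rw [SimpleGraph.isBridge_iff] at hbr
  set F' := F.deleteEdges {s(d.fst, d.snd)} with hF'
  let A : Finset V := Finset.univ.filter fun w => F'.Reachable d.fst w
  have hsym : d.symm ∉ T₀.darts := fun h => d.symm_ne (T₀.injOn h hd d.edge_symm)
  have hstep : ∀ e : G.Dart, e ∈ T₀.darts → e ≠ d → F'.Adj e.fst e.snd := by
    intro e he hne
    rw [hF', SimpleGraph.deleteEdges_adj]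
    refine ⟨hadj e he, fun h => hne (T₀.injOn he hd ?_)⟩
    exact h
  have hsum : ∑ i ∈ A, netOutflow G κ i = 0 := by
    have : netOutflow G κ = 0 := hκ
    simp [this]
  rw [sum_netOutflow_eq, Finset.sum_eq_single d] at hsum
  · rwa [hout _ hsym, sub_zero] at hsum
  · intro e he hne
    simp only [A, Finset.mem_filter, Finset.mem_univ, true_and] at he
    have h1 : e ∉ T₀.darts := fun h => he.2 (he.1.trans (hstep e h hne).reachable)
    have h2 : e.symm ∉ T₀.darts := fun h => by
      by_cases hs : e.symm = d
      · have : e.snd = d.fst := by rw [← hs]; rfl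
        exact he.2 (this ▸ SimpleGraph.Reachable.refl _)
      · exact he.2 (he.1.trans (hstep _ h hs).symm.reachable)
    rw [hout _ h1, hout _ h2, sub_zero]
  · intro h
    exact absurd (by simpa [A] using hbr) h

theorem restrict_bijective (T₀ : DirectedSpanningTree G) :
    Function.Bijective (restrict T₀) := by
  classical
  have hinj := restrict_injective T₀
  refine ⟨hinj, ?_⟩
  have hcard : T₀.darts.card + 1 = Fintype.card V := by
    have h := T₀.isSpanningTree.2.card_edgeFinset
    rw [← h, ← Finset.card_image_of_injOn T₀.injOn]
    congr 2
    ext e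
    simp only [SimpleGraph.mem_edgeFinset, SimpleGraph.edgeSet_fromEdgeSet, Set.mem_sdiff,
      Finset.mem_coe]
    refine ⟨fun he => ⟨he, ?_⟩, fun he => he.1⟩
    exact SimpleGraph.not_isDiag_of_mem_edgeSet G (T₀.isSpanningTree.1 (Finset.mem_coe.2 he))
  have hcod : Module.finrank ℝ ({d : G.Dart // d ∉ T₀.darts} → ℝ) =
      Fintype.card G.Dart - T₀.darts.card := by
    rw [Module.finrank_fintype_fun_eq_card, Fintype.card_subtype_compl, Fintype.card_coe]
  have hrange : Module.finrank ℝ (LinearMap.range (netOutflow G)) < Fintype.card V := by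
    rw [← Module.finrank_fintype_fun_eq_card ℝ (η := V)]
    refine Submodule.finrank_lt fun htop => ?_
    obtain ⟨i⟩ := T₀.isSpanningTree.2.connected.nonempty
    have hi : (Pi.single i 1 : V → ℝ) ∈ LinearMap.range (netOutflow G) := htop ▸ trivial
    obtain ⟨κ, hκ⟩ := hi
    have hs := sum_netOutflow_eq κ Finset.univ
    rw [hκ] at hs
    simp at hs
  have hker := LinearMap.finrank_range_add_finrank_ker (netOutflow G)
  rw [Module.finrank_fintype_fun_eq_card] at hker
  have hle : Module.finrank ℝ (Currents G) ≤
      Module.finrank ℝ ({d : G.Dart // d ∉ T₀.darts} → ℝ) :=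
    LinearMap.finrank_le_finrank_of_injective hinj
  have hC : Module.finrank ℝ (Currents G) =
      Module.finrank ℝ (LinearMap.ker (netOutflow G)) := rfl
  exact (LinearMap.injective_iff_surjective_of_finrank_eq_finrank (by omega)).1 hinj

/-- The Lebesgue measure `dκ_ℋ` on `ℋ`, for a directed reference spanning tree `T₀`: the image
of the Lebesgue measure on `ℝ^(E⃗ ∖ T₀)` under `ι⁻¹`. -/
def currentVolume (T₀ : DirectedSpanningTree G) : Measure (Currents G) :=
  (volume : Measure ({d : G.Dart // d ∉ T₀.darts} → ℝ)).map
    (LinearEquiv.ofBijective (restrict T₀) (restrict_bijective T₀)).symm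

end Currents

/-! ### Pinned fields -/

/-- `Ω_{i₀} = {u ∈ ℝ^V : u_{i₀} = 0}`. -/
abbrev Pinned (i₀ : V) : Type _ := {u : V → ℝ // u i₀ = 0}

/-- Extension by `0` at `i₀` of a vector indexed by `V ∖ {i₀}`. -/
def extendZero (i₀ : V) (x : {i : V // i ≠ i₀} → ℝ) : Pinned i₀ :=
  ⟨fun i => if h : i = i₀ then 0 else x ⟨i, h⟩, by simp⟩

/-- The measure `∏_{i ≠ i₀} du_i` on `Ω_{i₀}`. -/
def pinnedVolume (i₀ : V) : Measure (Pinned i₀) :=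
  (volume : Measure ({i : V // i ≠ i₀} → ℝ)).map (extendZero i₀)

/-- The measure `∏_{i ≠ i₀} 1_{u_i = v_i} du_i` on pairs `(v, u)`: the image of
`∏_{i ≠ i₀} du_i` under `u ↦ (u, u)`. -/
def diagonalVolume (i₀ : V) : Measure (Pinned i₀ × Pinned i₀) :=
  (pinnedVolume i₀).map fun u => (u, u)

/-! ### Weights and densities -/

/-- `u_i + u_j` for an undirected edge `{i, j}`. -/
def edgeSum (u : V → ℝ) (e : Sym2 V) : ℝ :=
  Sym2.lift ⟨fun i j => u i + u j, fun i j => add_comm (u i) (u j)⟩ e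

/-- The edge weight `W_{ij} e^{u_i + u_j} / 2`. -/
def omega (W : Sym2 V → ℝ) (u : V → ℝ) (e : Sym2 V) : ℝ :=
  W e / 2 * Real.exp (edgeSum u e)

/-- `1 - cosh (u_i - u_j) - e^{u_i + u_j} (s_i - s_j)² / 2` for an undirected edge `{i, j}`. -/
def edgeAction (s u : V → ℝ) (e : Sym2 V) : ℝ :=
  Sym2.lift ⟨fun i j =>
    1 - Real.cosh (u i - u j) - 1 / 2 * Real.exp (u i + u j) * (s i - s j) ^ 2, fun i j => by
      beta_reduce
      rw [← Real.cosh_neg (u i - u j), neg_sub, add_comm (u i) (u j)]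
      ring⟩ e

section Measures

variable (G : SimpleGraph V) [DecidableRel G.Adj] (W : Sym2 V → ℝ) (i₀ : V)

/-- `exp (∑_{ij ∈ E} W_ij (1 - cosh (u_i - u_j) - e^{u_i + u_j} (s_i - s_j)² / 2))`. -/
def boltzmann (s u : V → ℝ) : ℝ :=
  Real.exp (∑ e ∈ G.edgeFinset, W e * edgeAction s u e)

/-- The density of the tree version of the `H^{2|2}` model. -/
def rhoSusy (s u : V → ℝ) (T' : SpanningTree G) : ℝ :=
  boltzmann G W s u
    * (∏ e ∈ T'.edges, W e * Real.exp (edgeSum u e))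
    * ∏ i : {i : V // i ≠ i₀}, Real.exp (-u i) / (2 * Real.pi)

/-- The tree version `μ^susy` of the `H^{2|2}` model, as a measure in `(s, u, T')`. -/
def muSusy : Measure (Pinned i₀ × Pinned i₀ × SpanningTree G) :=
  ((pinnedVolume i₀).prod ((pinnedVolume i₀).prod Measure.count)).withDensity
    fun x => ENNReal.ofReal (rhoSusy G W i₀ x.1 x.2.1 x.2.2)

/-- The density `ρ^big` of the extended `H^{2|2}` model. -/
def rhoBig (κ κ' : G.Dart → ℝ) (s v u : V → ℝ) (i₁ i₁' : V) (T T' : SpanningTree G) : ℝ :=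
  (4 : ℝ) ^ (Fintype.card V - 1) / (2 * Real.pi) ^ (2 * G.edgeFinset.card)
    * boltzmann G W s u
    * (∏ e ∈ T.edges, omega W u e)
    * (∏ e ∈ T'.edges, omega W u e)
    * (∏ e ∈ G.edgeFinset, 1 / omega W u e ^ 2)
    * Real.exp (-∑ d : G.Dart, (κ d ^ 2 + κ' d ^ 2) / (2 * omega W u d.edge))
    * (Real.exp (2 * v i₁ + 2 * u i₁')
        / ((∑ i, Real.exp (2 * v i)) * ∑ j, Real.exp (2 * u j)))
    * ∏ i : {i : V // i ≠ i₀}, Real.exp (-u i)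

variable [MeasurableSpace V]

/-- The space `ℋ² × Ω_{i₀}³ × V² × 𝒯²`, with coordinates
`(κ, κ', s, (v, u), i₁, i₁', T, T')`. -/
abbrev BigSpace : Type _ :=
  Currents G × Currents G × Pinned i₀ × (Pinned i₀ × Pinned i₀) × V × V ×
    SpanningTree G × SpanningTree G

variable {G} in
/-- The extended `H^{2|2}` model `μ^big`, where `T₀` is the directed reference spanning tree
in the definition of the Lebesgue measure on `ℋ`. -/
def muBig (T₀ : DirectedSpanningTree G) : Measure (BigSpace G i₀) :=
  ((currentVolume T₀).prod ((currentVolume T₀).prod ((pinnedVolume i₀).prod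
    ((diagonalVolume i₀).prod (Measure.count.prod (Measure.count.prod
      (Measure.count.prod Measure.count))))))).withDensity
    fun ⟨κ, κ', s, (v, u), i₁, i₁', T, T'⟩ =>
      ENNReal.ofReal (rhoBig G W i₀ κ κ' s v u i₁ i₁' T T')

/-- The density of the marginal of `(s, u, i₁, i₁', T, T')` under the extended model. -/
def rhoMarginal (s u : V → ℝ) (i₁ i₁' : V) (T T' : SpanningTree G) : ℝ :=
  1 / Real.pi ^ (Fintype.card V - 1)
    * boltzmann G W s u
    * (∏ e ∈ T'.edges, omega W u e)
    * ((∏ e ∈ T.edges, omega W u e) / ∑ S : SpanningTree G, ∏ e ∈ S.edges, omega W u e)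
    * (Real.exp (2 * u i₁ + 2 * u i₁') / (∑ j, Real.exp (2 * u j)) ^ 2)
    * ∏ i : {i : V // i ≠ i₀}, Real.exp (-u i)

/-- The reference measure `∏_{i ≠ i₀} ds_i du_i · di₁ di₁' dT dT'`. -/
def marginalVolume : Measure (Pinned i₀ × Pinned i₀ × V × V × SpanningTree G × SpanningTree G) :=
  (pinnedVolume i₀).prod ((pinnedVolume i₀).prod (Measure.count.prod (Measure.count.prod
    (Measure.count.prod Measure.count))))

end Measures

end

end ExtendedH22

/-! Write $n=|V|-1$ and let $L$ be the graph Laplacian with weights $\omega'$, row and column of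
$i_0$ deleted. Given the other variables, $\kappa$ and $\kappa'$ enter the density as independent
centred Gaussians on $\mathcal H$. The Gaussian on all of $\mathbb R^{\vec E}$ has known mass, and
for its quadratic form $\mathcal H$ is orthogonal to the gradient flows
$\omega'_{ij}(\varphi_i-\varphi_j)$. Since the incidence matrix of $\vec T_0$ is unimodular,
splitting Lebesgue measure along this decomposition has Jacobian $\det 2L$ (`lintegral_flow_eq`).
Hence the integral over $\mathcal H$ is
$(2\pi)^{|E|}\prod_e\omega'_e\,/\,\big((2\pi)^{n/2}\sqrt{\det 2L}\big)$ (`lintegral_exp_currents`).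
Two such factors remove the square root, and $\det L$ is the spanning tree sum by the matrix-tree
theorem (`det_reducedLaplacian`); this is the first marginal. The second follows because the weights
of $T$, $i_1$ and $i_1'$ are normalised.

Total mass one reduces to the mass of $\mu^{\mathrm{susy}}$. Summing over $T'$ produces the
determinant of the Laplacian with weights $W_{ij}e^{u_i+u_j}$, and the Gaussian integral over $s$
leaves its square root. The remaining integral over $u$ is evaluated through a random Schrödinger
operator. Put $a_i=\sum_k W_{ik}e^{u_k-u_i}$, $H=\mathrm{diag}(a)-W$ on $V\setminus\{i_0\}$ and
$\eta_i=W_{ii_0}$. Then $He^u=\eta$, and $u\mapsto a$ is a bijection onto $\{H>0\}$ with Jacobian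
$\pm\det H$ (`range_fieldPotential`, `hasFDerivAt_fieldPotential`). The integrand becomes
$\exp(-\frac12\langle1,H1\rangle-\frac12\langle\eta,H^{-1}\eta\rangle+\sum_i\eta_i)/\sqrt{\det H}$.

For all $W\ge0$ and $\eta\ge0$ this has integral $(2\pi)^{n/2}$ (`lintegral_schroedingerDensity`).
The proof removes one vertex at a time. The Schur complement $y$ of the removed vertex contributes
the integral of $e^{-(y+b^2/y)/2}/\sqrt y$ over $y>0$, equal to $\sqrt{2\pi}\,e^{-b}$
(`lintegral_inverseGaussian`), and the rest has the same form with $\eta$ replaced by $\eta+w$,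
where $w$ is the removed column of $W$. -/

namespace ExtendedH22

/-! ### Cauchy-Binet for weighted sums of rank-one matrices -/

section CauchyBinet

variable {n ι R : Type*} [Fintype n] [DecidableEq n] [CommRing R]

/-- Multilinear expansion of the determinant of a sum of rank-one matrices. -/
theorem det_sum_mul (s : Finset ι) (a b : ι → n → R) :
    (Matrix.of fun i j => ∑ e ∈ s, a e i * b e j).det =
      ∑ f ∈ Fintype.piFinset (fun _ : n => s),
        (∏ i, a (f i) i) * (Matrix.of fun i j => b (f i) j).det := by
  have h := (Matrix.detRowAlternating (R := R) (n := n)).toMultilinearMap.map_sum_finset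
    (fun i e => a e i • b e) (fun _ => s)
  have h1 : (fun i => ∑ e ∈ s, a e i • b e) =
      (Matrix.of fun i j => ∑ e ∈ s, a e i * b e j : Matrix n n R) := by
    ext i j
    simp [Finset.sum_apply]
  rw [h1] at h
  refine h.trans (Finset.sum_congr rfl fun f _ => ?_)
  rw [MultilinearMap.map_smul_univ]
  rfl

/-- The maps with image `S` are exactly `g ∘ σ` for permutations `σ`. Permuting the rows of the
determinant yields `sign σ`, and the leftover signed sum of products is the Leibniz expansion of a
second copy of the same determinant. -/
theorem sum_image_eq_det_sq [DecidableEq ι] (s : Finset ι) (w : ι → R) (b : ι → n → R)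
    (S : Finset ι)
    (hS : S ⊆ s) (g : n → ι) (hg : Function.Injective g) (hgS : Finset.univ.image g = S) :
    ∑ f ∈ Fintype.piFinset (fun _ : n => s) with Finset.univ.image f = S,
        (∏ i, w (f i) * b (f i) i) * (Matrix.of fun i j => b (f i) j).det =
      (∏ e ∈ S, w e) * (Matrix.of fun i j => b (g i) j).det ^ 2 := by
  have hR : (∏ e ∈ S, w e) * (Matrix.of fun i j => b (g i) j).det ^ 2 =
      ∑ σ : Equiv.Perm n, (∏ i, w (g (σ i)) * b (g (σ i)) i) *
        (Matrix.of fun i j => b (g (σ i)) j).det := by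
    have h1 : ∀ σ : Equiv.Perm n, (∏ i, w (g (σ i)) * b (g (σ i)) i) *
        (Matrix.of fun i j => b (g (σ i)) j).det =
        (∏ e ∈ S, w e) * (Matrix.of fun i j => b (g i) j).det *
          (((Equiv.Perm.sign σ : ℤ) : R) * ∏ i, b (g (σ i)) i) := by
      intro σ
      have h2 := Matrix.det_permute σ (Matrix.of fun i j => b (g i) j)
      have h3 : (Matrix.of fun i j => b (g i) j).submatrix σ id =
        (Matrix.of fun i j => b (g (σ i)) j) := rfl
      rw [h3] at h2
      rw [h2, Finset.prod_mul_distrib, Equiv.prod_comp σ (fun i => w (g i)), ← hgS,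
        Finset.prod_image (fun _ _ _ _ h => hg h)]
      ring
    simp_rw [h1]
    rw [← Finset.mul_sum, pow_two, ← mul_assoc]
    congr 1
    rw [Matrix.det_apply']
    rfl
  rw [hR]
  symm
  refine Finset.sum_bij (fun σ _ => g ∘ σ) ?_ ?_ ?_ ?_
  · intro σ _
    rw [Finset.mem_filter, Fintype.mem_piFinset]
    have : Finset.univ.image (g ∘ σ) = S := by
      rw [← hgS, ← Finset.image_image, Finset.image_univ_equiv]
    refine ⟨fun i => hS (by
      rw [← this]
      exact Finset.mem_image_of_mem _ (Finset.mem_univ i)), this⟩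
  · intro σ _ τ _ h
    exact Equiv.ext fun i => hg (congrFun h i)
  · intro f hf
    rw [Finset.mem_filter] at hf
    have hcard : (Finset.univ.image f).card = (Finset.univ : Finset n).card := by
      rw [hf.2, ← hgS, Finset.card_image_of_injective _ hg]
    have hfi : Function.Injective f := by
      have := Finset.card_image_iff.1 hcard
      simpa [Set.injOn_univ] using this
    have hex : ∀ i, ∃ j, g j = f i := fun i => by
      have : f i ∈ Finset.univ.image g := by
        rw [hgS, ← hf.2]
        exact Finset.mem_image_of_mem _ (Finset.mem_univ i)
      simpa using this
    choose τ hτ using hex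
    have hτi : Function.Injective τ := fun i j h => hfi (by rw [← hτ, ← hτ, h])
    exact ⟨Equiv.ofBijective τ (Finite.injective_iff_bijective.1 hτi), Finset.mem_univ _,
      funext hτ⟩
  · intro σ _
    rfl

/-- A weighted form of the Cauchy-Binet formula. -/
theorem det_sum_mul_mul_eq [DecidableEq ι] (s : Finset ι) (w : ι → R) (b : ι → n → R)
    (d : Finset ι → R)
    (hd : ∀ g : n → ι, Function.Injective g → Finset.univ.image g ⊆ s →
      (Matrix.of fun i j => b (g i) j).det ^ 2 = d (Finset.univ.image g)) :
    (Matrix.of fun i j => ∑ e ∈ s, w e * (b e i * b e j)).det =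
      ∑ S ∈ s.powersetCard (Fintype.card n), (∏ e ∈ S, w e) * d S := by
  have h0 := det_sum_mul s (fun e i => w e * b e i) b
  simp_rw [mul_assoc] at h0
  rw [h0]
  -- Group the maps `f` by image. An image with fewer than `Fintype.card n` elements forces two
  -- equal rows and contributes zero.
  rw [← Finset.sum_fiberwise_of_maps_to (s := Fintype.piFinset (fun _ : n => s)) (t := s.powerset)
    (g := fun f => Finset.univ.image f)]
  · rw [← Finset.sum_subset (fun S hS => Finset.mem_powerset.2
      (Finset.mem_powersetCard.1 hS).1 : s.powersetCard (Fintype.card n) ⊆ s.powerset)]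
    · refine Finset.sum_congr rfl fun S hS => ?_
      rw [Finset.mem_powersetCard] at hS
      obtain ⟨e⟩ : Nonempty (n ≃ S) := Fintype.card_eq.1 (by simp [hS.2])
      have hgi : Function.Injective (fun i => (e i : ι)) :=
        Subtype.val_injective.comp e.injective
      have hgS : Finset.univ.image (fun i => (e i : ι)) = S := by
        ext x
        simp only [Finset.mem_image, Finset.mem_univ, true_and]
        exact ⟨fun ⟨i, hi⟩ => hi ▸ (e i).2, fun hx => ⟨e.symm ⟨x, hx⟩, by simp⟩⟩
      have := sum_image_eq_det_sq s w b S hS.1 _ hgi hgS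
      rw [hd _ hgi (hgS.symm ▸ hS.1), hgS] at this
      exact this
    · intro S hS hS'
      rw [Finset.mem_powerset] at hS
      refine Finset.sum_eq_zero fun f hf => ?_
      rw [Finset.mem_filter] at hf
      have : ¬ Function.Injective f := fun hfi => hS' (by
        rw [Finset.mem_powersetCard, ← hf.2, Finset.card_image_of_injective _ hfi]
        exact ⟨by rw [hf.2]; exact hS, rfl⟩)
      simp only [Function.Injective, not_forall] at this
      obtain ⟨i, j, hij, hne⟩ := this
      rw [Matrix.det_zero_of_row_eq hne (by ext k; simp [hij]), mul_zero]
  · intro f hf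
    rw [Fintype.mem_piFinset] at hf
    rw [Finset.mem_powerset]
    intro x hx
    obtain ⟨i, _, rfl⟩ := Finset.mem_image.1 hx
    exact hf i

end CauchyBinet

/-! ### Minors of the incidence matrix -/

section Incidence

variable {V : Type*} [Fintype V] [DecidableEq V]

/-- The signed incidence vector of the directed edge `p`. -/
def incidence (R : Type*) [Ring R] (p : V × V) (j : V) : R :=
  (if p.1 = j then 1 else 0) - (if p.2 = j then 1 else 0)

theorem sum_incidence_mul {R : Type*} [Ring R] (p : V × V) (φ : V → R) :
    ∑ j, incidence R p j * φ j = φ p.1 - φ p.2 := by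
  simp [incidence, sub_mul, Finset.sum_sub_distrib]

theorem sum_incidence_mul_of_eq_zero {R : Type*} [Ring R] {i₀ : V} (p : V × V) (φ : V → R)
    (h0 : φ i₀ = 0) :
    ∑ j : {j : V // j ≠ i₀}, incidence R p j * φ j = φ p.1 - φ p.2 := by
  rw [← sum_incidence_mul, ← Finset.sum_subtype (Finset.univ.erase i₀) (p := fun j => j ≠ i₀)
    (by simp) (fun j => incidence R p j * φ j)]
  exact Finset.sum_erase _ (by simp [h0])

/-- The incidence matrix of a tree, with the row of one vertex removed, is unimodular. -/
theorem det_incidence_sq_of_isTree {R : Type*} [CommRing R] {i₀ : V}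
    (g : {i : V // i ≠ i₀} → V × V)
    (hinj : Function.Injective fun i => s((g i).1, (g i).2))
    (hT : (SimpleGraph.fromEdgeSet (Set.range fun i => s((g i).1, (g i).2))).IsTree)
    (hne : ∀ i, (g i).1 ≠ (g i).2) :
    (Matrix.of fun i j : {i : V // i ≠ i₀} => incidence R (g i) j).det ^ 2 = 1 := by
  classical
  set F := SimpleGraph.fromEdgeSet (Set.range fun i => s((g i).1, (g i).2)) with hF
  have hadj : ∀ i, F.Adj (g i).1 (g i).2 := fun i => by
    rw [hF, SimpleGraph.fromEdgeSet_adj]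
    exact ⟨⟨i, rfl⟩, hne i⟩
  -- `C i` is the side of the tail of `g i` after this edge is cut out of the tree. Its indicator,
  -- shifted to vanish at `i₀`, jumps by 1 along edge `i` and along no other tree edge. These
  -- functions are therefore the columns of an integral inverse.
  set C : {i : V // i ≠ i₀} → V → Prop := fun i v =>
    (F.deleteEdges {s((g i).1, (g i).2)}).Reachable (g i).1 v with hC
  set φ : {i : V // i ≠ i₀} → V → ℤ := fun i v =>
    (if C i v then 1 else 0) - (if C i i₀ then 1 else 0) with hφ
  have hφ0 : ∀ i, φ i i₀ = 0 := fun i => by simp [hφ]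
  have hmul : (Matrix.of fun i j : {i : V // i ≠ i₀} => incidence ℤ (g i) j) *
      (Matrix.of fun j i : {i : V // i ≠ i₀} => φ i j) = 1 := by
    ext k i
    rw [Matrix.mul_apply]
    simp only [Matrix.of_apply]
    rw [sum_incidence_mul_of_eq_zero (g k) (φ i) (hφ0 i), Matrix.one_apply]
    have hbr : F.IsBridge s((g i).1, (g i).2) :=
      SimpleGraph.isAcyclic_iff_forall_adj_isBridge.1 hT.isAcyclic (hadj i)
    rw [SimpleGraph.isBridge_iff] at hbr
    split_ifs with hki
    · subst hki
      have h1 : C k (g k).1 := SimpleGraph.Reachable.refl _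
      have h2 : ¬ C k (g k).2 := hbr
      simp [hφ, h1, h2]
    · have h1 : (F.deleteEdges {s((g i).1, (g i).2)}).Adj (g k).1 (g k).2 := by
        rw [SimpleGraph.deleteEdges_adj]
        exact ⟨hadj k, fun h => hki (hinj h)⟩
      have h2 : C i (g k).1 ↔ C i (g k).2 :=
        ⟨fun h => h.trans h1.reachable, fun h => h.trans h1.symm.reachable⟩
      simp [hφ, h2]
  have hdet := congrArg Matrix.det hmul
  rw [Matrix.det_mul, Matrix.det_one] at hdet
  -- Working over `ℤ` first makes the determinant an integer unit, so its square is 1; the identity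
  -- is then transported to `R`.
  have hsq : (Matrix.of fun i j : {i : V // i ≠ i₀} => incidence ℤ (g i) j).det ^ 2 = 1 :=
    Int.isUnit_sq (IsUnit.of_mul_eq_one _ hdet)
  have hmap : (Matrix.of fun i j : {i : V // i ≠ i₀} => incidence R (g i) j) =
      (Int.castRingHom R).mapMatrix
        (Matrix.of fun i j : {i : V // i ≠ i₀} => incidence ℤ (g i) j) := by
    ext i j
    simp [incidence]
  rw [hmap, ← RingHom.map_det, ← map_pow, hsq, map_one]

/-- The indicator of a component that misses `i₀` is a nonzero vector in the kernel. -/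
theorem det_incidence_eq_zero_of_not_connected {R : Type*} [CommRing R] [IsDomain R] {i₀ : V}
    (g : {i : V // i ≠ i₀} → V × V)
    (hT : ¬ (SimpleGraph.fromEdgeSet (Set.range fun i => s((g i).1, (g i).2))).Connected) :
    (Matrix.of fun i j : {i : V // i ≠ i₀} => incidence R (g i) j).det = 0 := by
  classical
  set F := SimpleGraph.fromEdgeSet (Set.range fun i => s((g i).1, (g i).2)) with hF
  have hex : ∃ w, ¬ F.Reachable w i₀ := by
    by_contra! h
    have : Nonempty V := ⟨i₀⟩
    exact hT ⟨fun a b => (h a).trans (h b).symm⟩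
  obtain ⟨w, hw⟩ := hex
  refine Matrix.exists_mulVec_eq_zero_iff.1
    ⟨fun j => if F.Reachable w j then 1 else 0, fun h => ?_, ?_⟩
  · have hwi : w ≠ i₀ := fun h => hw (h ▸ SimpleGraph.Reachable.refl _)
    have := congrFun h ⟨w, hwi⟩
    simp at this
  · ext i
    rw [Matrix.mulVec, dotProduct]
    simp only [Matrix.of_apply]
    rw [sum_incidence_mul_of_eq_zero (g i) (fun j => if F.Reachable w j then (1 : R) else 0)
      (by simp [hw])]
    by_cases hne : (g i).1 = (g i).2
    · simp [hne]
    · have h1 : F.Adj (g i).1 (g i).2 := by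
        rw [hF, SimpleGraph.fromEdgeSet_adj]
        exact ⟨⟨i, rfl⟩, hne⟩
      have h2 : F.Reachable w (g i).1 ↔ F.Reachable w (g i).2 :=
        ⟨fun h => h.trans h1.reachable, fun h => h.trans h1.symm.reachable⟩
      simp [h2]

end Incidence

/-! ### The weighted matrix-tree theorem and the Dirichlet form -/

section MatrixTree

theorem sym2_mk_out {V : Type*} (e : Sym2 V) : s((Quot.out e).1, (Quot.out e).2) = e :=
  Quot.out_eq e

theorem sum_darts_eq {V : Type*} [Fintype V] (G : SimpleGraph V) [DecidableRel G.Adj]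
    (h : V → V → ℝ) :
    ∑ d : G.Dart, h d.fst d.snd = ∑ k, ∑ l, if G.Adj k l then h k l else 0 := by
  rw [← Fintype.sum_prod_type', ← Finset.sum_filter]
  refine Finset.sum_bij' (fun d _ => (d.fst, d.snd))
    (fun p hp => ⟨p, (Finset.mem_filter.1 hp).2⟩) ?_ ?_ ?_ ?_ ?_
  · intro d _
    simp [d.adj]
  · intro p _
    exact Finset.mem_univ _
  · intro d _
    rfl
  · intro p _
    rfl
  · intro d _
    rfl

variable {V : Type*} [Fintype V] [DecidableEq V]

theorem card_ne_add_one (i₀ : V) : Fintype.card {i : V // i ≠ i₀} + 1 = Fintype.card V := by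
  rw [Fintype.card_subtype_compl, Fintype.card_subtype_eq]
  exact Nat.sub_add_cancel (Fintype.card_pos_iff.2 ⟨i₀⟩)

theorem IsSpanningTree.card_add_one {G : SimpleGraph V} {T : Finset (Sym2 V)}
    (hT : IsSpanningTree G T) : T.card + 1 = Fintype.card V := by
  classical
  rw [← hT.2.card_edgeFinset]
  congr 2
  ext e
  simp only [SimpleGraph.mem_edgeFinset, SimpleGraph.edgeSet_fromEdgeSet, Set.mem_sdiff,
    Finset.mem_coe]
  exact ⟨fun he => ⟨he, SimpleGraph.not_isDiag_of_mem_edgeSet G (hT.1 (Finset.mem_coe.2 he))⟩,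
    fun he => he.1⟩

theorem IsSpanningTree.card_eq {G : SimpleGraph V} {T : Finset (Sym2 V)}
    (hT : IsSpanningTree G T) (i₀ : V) : T.card = Fintype.card {i : V // i ≠ i₀} := by
  have h1 := hT.card_add_one
  have h2 := card_ne_add_one i₀
  omega

variable (G : SimpleGraph V) [DecidableRel G.Adj]

/-- The weighted graph Laplacian, with the row and the column of `i₀` removed. -/
noncomputable def reducedLaplacian (ω : Sym2 V → ℝ) (i₀ : V) :
    Matrix {i : V // i ≠ i₀} {i : V // i ≠ i₀} ℝ :=
  Matrix.of fun i j => ∑ e ∈ G.edgeFinset,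
    ω e * (incidence ℝ (Quot.out e) i * incidence ℝ (Quot.out e) j)

/-- The weighted matrix-tree theorem. -/
theorem det_reducedLaplacian (ω : Sym2 V → ℝ) (i₀ : V) :
    (reducedLaplacian G ω i₀).det = ∑ T : SpanningTree G, ∏ e ∈ T.edges, ω e := by
  classical
  rw [reducedLaplacian, det_sum_mul_mul_eq G.edgeFinset ω
    (fun e (j : {i : V // i ≠ i₀}) => incidence ℝ (Quot.out e) j)
    (fun S => if IsSpanningTree G S then 1 else 0)]
  · simp only [mul_ite, mul_one, mul_zero]
    rw [← Finset.sum_filter]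
    refine Finset.sum_bij' (fun S hS => (⟨S, (Finset.mem_filter.1 hS).2⟩ : SpanningTree G))
      (fun T _ => T.1) ?_ ?_ ?_ ?_ ?_
    · intro S _
      exact Finset.mem_univ _
    · intro T _
      rw [Finset.mem_filter, Finset.mem_powersetCard]
      refine ⟨⟨fun e he => ?_, T.2.card_eq i₀⟩, T.2⟩
      exact SimpleGraph.mem_edgeFinset.2 (T.2.1 (Finset.mem_coe.2 he))
    · intro S _
      rfl
    · intro T _
      rfl
    · intro S _
      rfl
  · intro g hg hgs
    have hmem : ∀ i, g i ∈ G.edgeSet := fun i =>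
      SimpleGraph.mem_edgeFinset.1 (hgs (Finset.mem_image_of_mem _ (Finset.mem_univ i)))
    have hrange : (Set.range fun i => s((Quot.out (g i)).1, (Quot.out (g i)).2)) =
        ((Finset.univ.image g : Finset (Sym2 V)) : Set (Sym2 V)) := by
      simp [sym2_mk_out]
    have hsub : ((Finset.univ.image g : Finset (Sym2 V)) : Set (Sym2 V)) ⊆ G.edgeSet := by
      intro e he
      exact SimpleGraph.mem_edgeFinset.1 (hgs (Finset.mem_coe.1 he))
    split_ifs with hT
    · refine det_incidence_sq_of_isTree (fun i => Quot.out (g i)) ?_ ?_ ?_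
      · intro i j h
        simp only [sym2_mk_out] at h
        exact hg h
      · rw [hrange]
        exact hT.2
      · intro i h
        refine SimpleGraph.not_isDiag_of_mem_edgeSet G (hmem i) ?_
        rw [← sym2_mk_out (g i)]
        exact Sym2.mk_isDiag_iff.2 h
    -- The set has `|V| - 1` edges, so if it were connected it would be a spanning tree.
    · rw [det_incidence_eq_zero_of_not_connected (fun i => Quot.out (g i)), zero_pow two_ne_zero]
      rw [hrange]
      intro hc
      refine hT ⟨hsub, SimpleGraph.isTree_iff_connected_and_card.2 ⟨hc, ?_⟩⟩
      have : (SimpleGraph.fromEdgeSet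
          ((Finset.univ.image g : Finset (Sym2 V)) : Set (Sym2 V))).edgeSet =
          ((Finset.univ.image g : Finset (Sym2 V)) : Set (Sym2 V)) := by
        rw [SimpleGraph.edgeSet_fromEdgeSet]
        ext e
        refine ⟨fun h => h.1, fun h => ⟨h, SimpleGraph.not_isDiag_of_mem_edgeSet G (hsub h)⟩⟩
      rw [this, Nat.card_coe_set_eq, Set.ncard_coe_finset, Finset.card_image_of_injective _ hg,
        Finset.card_univ, card_ne_add_one, Nat.card_eq_fintype_card]

theorem sum_darts_edge (h : Sym2 V → ℝ) :
    ∑ d : G.Dart, h d.edge = 2 * ∑ e ∈ G.edgeFinset, h e := by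
  rw [← Finset.sum_fiberwise_of_maps_to (s := Finset.univ) (t := G.edgeFinset)
    (g := fun d : G.Dart => d.edge), Finset.mul_sum]
  · refine Finset.sum_congr rfl fun e he => ?_
    rw [Finset.sum_congr rfl (g := fun _ => h e), Finset.sum_const,
      G.dart_edge_fiber_card e (SimpleGraph.mem_edgeFinset.1 he)]
    · simp
    · intro d hd
      rw [(Finset.mem_filter.1 hd).2]
  · intro d _
    exact SimpleGraph.mem_edgeFinset.2 d.edge_mem

theorem sum_edges_eq (h : Sym2 V → ℝ) :
    2 * ∑ e ∈ G.edgeFinset, h e = ∑ k, ∑ l, if G.Adj k l then h s(k, l) else 0 := by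
  rw [← sum_darts_edge, ← sum_darts_eq]
  rfl

-- Reversing the orientation picked by `Quot.out` flips both signs, so the rank-one summands of the
-- Laplacian do not depend on it.
omit [Fintype V] in
theorem incidence_out_mul (k l : V) (i j : V) :
    incidence ℝ (Quot.out s(k, l)) i * incidence ℝ (Quot.out s(k, l)) j =
      incidence ℝ (k, l) i * incidence ℝ (k, l) j := by
  have h := sym2_mk_out s(k, l)
  rw [Sym2.eq_iff] at h
  rcases h with ⟨h1, h2⟩ | ⟨h1, h2⟩
  · simp only [incidence, h1, h2]
  · simp only [incidence, h1, h2]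
    ring

theorem two_mul_reducedLaplacian_apply (ω : Sym2 V → ℝ) (i₀ : V) (i j : {i : V // i ≠ i₀}) :
    2 * reducedLaplacian G ω i₀ i j = ∑ k, ∑ l, if G.Adj k l then
      ω s(k, l) * (incidence ℝ (k, l) i * incidence ℝ (k, l) j) else 0 := by
  rw [reducedLaplacian, Matrix.of_apply, sum_edges_eq]
  simp only [incidence_out_mul]

/-- Summing over ordered pairs counts each edge twice. Of the four terms in the product of two
incidence vectors, two give the diagonal and two the off-diagonal entry, which absorbs the factor 2.
-/
theorem reducedLaplacian_apply (ω : Sym2 V → ℝ) (i₀ : V) (i j : {i : V // i ≠ i₀}) :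
    reducedLaplacian G ω i₀ i j =
      (if i = j then ∑ k, if G.Adj i k then ω s(↑i, k) else 0 else 0) -
        if G.Adj i j then ω s(↑i, ↑j) else 0 := by
  have h := two_mul_reducedLaplacian_apply G ω i₀ i j
  have hA : ∀ k l, (if G.Adj k l then
      ω s(k, l) * (incidence ℝ (k, l) i * incidence ℝ (k, l) j) else 0) =
      (if k = (i : V) then if k = (j : V) then if G.Adj k l then ω s(k, l) else 0 else 0 else 0)
      - (if k = (i : V) then if l = (j : V) then if G.Adj k l then ω s(k, l) else 0 else 0 else 0)
      - (if l = (i : V) then if k = (j : V) then if G.Adj k l then ω s(k, l) else 0 else 0 else 0)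
      + (if l = (i : V) then if l = (j : V) then if G.Adj k l then ω s(k, l) else 0 else 0 else 0)
      := by
    intro k l
    simp only [incidence]
    split_ifs <;> simp
  simp_rw [hA, Finset.sum_add_distrib, Finset.sum_sub_distrib] at h
  have e1 : ∑ k, ∑ l, (if k = (i : V) then if k = (j : V) then
      if G.Adj k l then ω s(k, l) else 0 else 0 else 0) =
      if i = j then ∑ k, if G.Adj i k then ω s(↑i, k) else 0 else 0 := by
    rw [Finset.sum_eq_single (i : V) (fun k _ hk => by simp [hk]) (by simp)]
    by_cases hij : i = j
    · simp [hij]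
    · have : (i : V) ≠ j := fun h => hij (Subtype.ext h)
      simp [hij, this]
  have e4 : ∑ k, ∑ l, (if l = (i : V) then if l = (j : V) then
      if G.Adj k l then ω s(k, l) else 0 else 0 else 0) =
      if i = j then ∑ k, if G.Adj i k then ω s(↑i, k) else 0 else 0 := by
    rw [Finset.sum_comm, ← e1]
    refine Finset.sum_congr rfl fun k _ => Finset.sum_congr rfl fun l _ => ?_
    simp only [G.adj_comm l k, Sym2.eq_swap (a := l) (b := k)]
  have e2 : ∑ k, ∑ l, (if k = (i : V) then if l = (j : V) then
      if G.Adj k l then ω s(k, l) else 0 else 0 else 0) =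
      if G.Adj i j then ω s(↑i, ↑j) else 0 := by
    rw [Finset.sum_eq_single (i : V) (fun k _ hk => by simp [hk]) (by simp)]
    simp
  have e3 : ∑ k, ∑ l, (if l = (i : V) then if k = (j : V) then
      if G.Adj k l then ω s(k, l) else 0 else 0 else 0) =
      if G.Adj i j then ω s(↑i, ↑j) else 0 := by
    rw [Finset.sum_comm, ← e2]
    refine Finset.sum_congr rfl fun k _ => Finset.sum_congr rfl fun l _ => ?_
    simp only [G.adj_comm l k, Sym2.eq_swap (a := l) (b := k)]
  rw [e1, e2, e3, e4] at h
  linarith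

theorem reducedLaplacian_mulVec (ω : Sym2 V → ℝ) (i₀ : V) (x : V → ℝ) (hx : x i₀ = 0)
    (i : {i : V // i ≠ i₀}) :
    (reducedLaplacian G ω i₀).mulVec (fun j => x j) i =
      ∑ k, if G.Adj i k then ω s(↑i, k) * (x i - x k) else 0 := by
  have h1 : ∑ j : {j : V // j ≠ i₀}, (if G.Adj i j then ω s(↑i, ↑j) else 0) * x j =
      ∑ k, (if G.Adj i k then ω s(↑i, k) else 0) * x k := by
    rw [← Finset.sum_subtype (Finset.univ.erase i₀) (p := fun j => j ≠ i₀)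
      (by simp) (fun j => (if G.Adj i j then ω s(↑i, j) else 0) * x j)]
    exact Finset.sum_erase _ (by simp [hx])
  simp only [Matrix.mulVec, dotProduct, reducedLaplacian_apply, sub_mul, Finset.sum_sub_distrib,
    ite_mul, zero_mul, Finset.sum_ite_eq, Finset.mem_univ, if_true]
  simp only [ite_mul, zero_mul] at h1
  rw [h1, Finset.sum_mul, ← Finset.sum_sub_distrib]
  refine Finset.sum_congr rfl fun k _ => ?_
  split_ifs
  · ring
  · ring

theorem reducedLaplacian_quadratic (ω : Sym2 V → ℝ) (i₀ : V) (x : V → ℝ) (hx : x i₀ = 0) :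
    (fun j : {j : V // j ≠ i₀} => x j) ⬝ᵥ (reducedLaplacian G ω i₀).mulVec (fun j => x j) =
      ∑ e ∈ G.edgeFinset, ω e * (x (Quot.out e).1 - x (Quot.out e).2) ^ 2 := by
  have h1 : ∀ i, (reducedLaplacian G ω i₀).mulVec (fun j => x j) i =
      ∑ e ∈ G.edgeFinset, ω e * (incidence ℝ (Quot.out e) i *
        (x (Quot.out e).1 - x (Quot.out e).2)) := by
    intro i
    simp only [Matrix.mulVec, dotProduct, reducedLaplacian, Matrix.of_apply, Finset.sum_mul]
    rw [Finset.sum_comm]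
    refine Finset.sum_congr rfl fun e _ => ?_
    rw [← sum_incidence_mul_of_eq_zero _ x hx, Finset.mul_sum, Finset.mul_sum]
    exact Finset.sum_congr rfl fun j _ => by ring
  simp only [dotProduct, h1, Finset.mul_sum]
  rw [Finset.sum_comm]
  refine Finset.sum_congr rfl fun e _ => ?_
  rw [pow_two]
  nth_rw 2 [← sum_incidence_mul_of_eq_zero _ x hx]
  rw [Finset.sum_mul, Finset.mul_sum]
  exact Finset.sum_congr rfl fun j _ => by ring

/-- The quadratic form is a Dirichlet form. If it vanishes, the potential agrees at neighbouring
vertices, and connectedness spreads its value 0 at `i₀` to all of `V`. -/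
theorem reducedLaplacian_posDef (hG : G.Connected) (ω : Sym2 V → ℝ)
    (hω : ∀ e ∈ G.edgeSet, 0 < ω e) (i₀ : V) : (reducedLaplacian G ω i₀).PosDef := by
  refine Matrix.PosDef.of_dotProduct_mulVec_pos ?_ fun {x} hx => ?_
  · ext i j
    simp only [reducedLaplacian, Matrix.conjTranspose_apply, Matrix.of_apply, star_trivial]
    exact Finset.sum_congr rfl fun e _ => by ring
  · set y : V → ℝ := (extendZero i₀ x : V → ℝ) with hy
    have hxy : x = fun j : {j : V // j ≠ i₀} => y j := by
      funext j
      simp [hy, extendZero, j.2]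
    have hy0 : y i₀ = 0 := (extendZero i₀ x).2
    rw [star_trivial, hxy, reducedLaplacian_quadratic G ω i₀ y hy0]
    have hnn : ∀ e ∈ G.edgeFinset, 0 ≤ ω e * (y (Quot.out e).1 - y (Quot.out e).2) ^ 2 :=
      fun e he => mul_nonneg (hω e (SimpleGraph.mem_edgeFinset.1 he)).le (sq_nonneg _)
    refine lt_of_le_of_ne (Finset.sum_nonneg hnn) fun h0 => hx ?_
    have h1 := (Finset.sum_eq_zero_iff_of_nonneg hnn).1 h0.symm
    have hadj : ∀ k l, G.Adj k l → y k = y l := by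
      intro k l hkl
      have h2 := h1 s(k, l) (SimpleGraph.mem_edgeFinset.2 hkl)
      have h3 := (mul_eq_zero.1 h2).resolve_left (hω _ hkl).ne'
      have h4 := sub_eq_zero.1 (pow_eq_zero_iff two_ne_zero |>.1 h3)
      have h := sym2_mk_out s(k, l)
      rw [Sym2.eq_iff] at h
      rcases h with ⟨ha, hb⟩ | ⟨ha, hb⟩
      · rwa [ha, hb] at h4
      · rw [ha, hb] at h4
        exact h4.symm
    have hwalk : ∀ k l, G.Walk k l → y k = y l := fun k l p => by
      clear * - p hadj
      induction p with
      | nil => rfl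
      | cons h _ ih => exact (hadj _ _ h).trans ih
    have hall : ∀ k, y k = 0 := by
      intro k
      obtain ⟨p⟩ := hG.preconnected k i₀
      exact (hwalk _ _ p).trans hy0
    rw [hxy]
    funext j
    exact hall j

end MatrixTree

/-! ### Gaussian integrals -/

section Gaussian

theorem lintegral_exp_neg_mul_sq {c : ℝ} (hc : 0 < c) :
    ∫⁻ x : ℝ, ENNReal.ofReal (Real.exp (-c * x ^ 2)) = ENNReal.ofReal (√(Real.pi / c)) := by
  rw [← integral_gaussian, ofReal_integral_eq_lintegral_ofReal (integrable_exp_neg_mul_sq hc)]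
  exact ae_of_all _ fun x => (Real.exp_pos _).le

theorem lintegral_exp_neg_sum_sq {n : Type*} [Fintype n] {c : n → ℝ} (hc : ∀ i, 0 < c i) :
    ∫⁻ x : n → ℝ, ENNReal.ofReal (Real.exp (-∑ i, c i * x i ^ 2)) =
      ENNReal.ofReal (∏ i, √(Real.pi / c i)) := by
  have h : ∀ x : n → ℝ, Real.exp (-∑ i, c i * x i ^ 2) = ∏ i, Real.exp (-c i * x i ^ 2) := by
    intro x
    rw [← Real.exp_sum, ← Finset.sum_neg_distrib]
    simp only [neg_mul]
  simp_rw [h]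
  rw [← ofReal_integral_eq_lintegral_ofReal]
  · rw [integral_fintype_prod_volume_eq_prod (fun i (t : ℝ) => Real.exp (-c i * t ^ 2))]
    simp only [integral_gaussian]
  · exact Integrable.fintype_prod (f := fun i (t : ℝ) => Real.exp (-c i * t ^ 2))
      fun i => integrable_exp_neg_mul_sq (hc i)
  · exact ae_of_all _ fun x => Finset.prod_nonneg fun i _ => (Real.exp_pos _).le

theorem lintegral_comp_mulVec {n : Type*} [Fintype n] [DecidableEq n] (M : Matrix n n ℝ)
    (hM : M.det ≠ 0) (f : (n → ℝ) → ℝ≥0∞) :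
    ∫⁻ x, f x = ENNReal.ofReal |M.det| * ∫⁻ x, f (M.mulVec x) := by
  have hinj : Function.Injective fun x => M.mulVec x :=
    Matrix.mulVec_injective_iff_isUnit.2 ((Matrix.isUnit_iff_isUnit_det _).2 hM.isUnit)
  have hsurj : Function.Surjective fun x => M.mulVec x :=
    Matrix.mulVec_surjective_iff_isUnit.2 ((Matrix.isUnit_iff_isUnit_det _).2 hM.isUnit)
  have h := lintegral_image_eq_lintegral_abs_det_fderiv_mul (volume : Measure (n → ℝ))
    (s := Set.univ) (f := fun x => M.mulVec x)
    (f' := fun _ => (Matrix.toLin' M).toContinuousLinearMap) MeasurableSet.univ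
    (fun x _ => by
      exact ((Matrix.toLin' M).toContinuousLinearMap.hasFDerivAt).hasFDerivWithinAt)
    hinj.injOn f
  rw [Set.image_univ, hsurj.range_eq, Measure.restrict_univ] at h
  have hdet : ((Matrix.toLin' M).toContinuousLinearMap).det = M.det := by
    rw [ContinuousLinearMap.det, LinearMap.coe_toContinuousLinearMap, LinearMap.det_toLin']
  rw [h, hdet, lintegral_const_mul' _ _ ENNReal.ofReal_ne_top]

-- Factor `A = Bᵀ B` and substitute `y = B x`; then `|det B| = √(det A)`.
open scoped MatrixOrder Matrix.Norms.L2Operator in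
theorem lintegral_exp_neg_quadratic {n : Type*} [Fintype n] [DecidableEq n] (A : Matrix n n ℝ)
    (hA : A.PosDef) :
    ∫⁻ x : n → ℝ, ENNReal.ofReal (Real.exp (-(x ⬝ᵥ A.mulVec x) / 2)) =
      ENNReal.ofReal (√(2 * Real.pi) ^ Fintype.card n / √A.det) := by
  obtain ⟨B, hB⟩ : ∃ B : Matrix n n ℝ, A = B.transpose * B := by
    obtain ⟨B, hB⟩ := CStarAlgebra.nonneg_iff_eq_star_mul_self.1 hA.posSemidef.nonneg
    exact ⟨B, by rw [hB, Matrix.star_eq_conjTranspose,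
      Matrix.conjTranspose_eq_transpose_of_trivial]⟩
  have hdet : A.det = B.det ^ 2 := by
    rw [hB, Matrix.det_mul, Matrix.det_transpose, pow_two]
  have hB0 : B.det ≠ 0 := fun h => hA.det_pos.ne' (by rw [hdet, h]; simp)
  have hq : ∀ x : n → ℝ, Real.exp (-(x ⬝ᵥ A.mulVec x) / 2) =
      Real.exp (-∑ i, (1 / 2) * (B.mulVec x) i ^ 2) := by
    intro x
    rw [hB, ← Matrix.mulVec_mulVec, Matrix.dotProduct_mulVec, Matrix.vecMul_transpose,
      ← Finset.mul_sum, dotProduct]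
    simp only [pow_two]
    ring_nf
  have h := lintegral_comp_mulVec B hB0
    (fun y => ENNReal.ofReal (Real.exp (-∑ i, (1 / 2) * y i ^ 2)))
  rw [lintegral_exp_neg_sum_sq (fun _ => by norm_num)] at h
  simp_rw [hq]
  have hs : √A.det = |B.det| := by rw [hdet, Real.sqrt_sq_eq_abs]
  have hpos : 0 < |B.det| := abs_pos.2 hB0
  have hne : ENNReal.ofReal |B.det| ≠ 0 := by simpa using hB0
  rw [hs, ENNReal.ofReal_div_of_pos hpos, ENNReal.eq_div_iff hne ENNReal.ofReal_ne_top, ← h]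
  simp [mul_comm]

end Gaussian

/-! ### The inverse Gaussian integral -/

section InverseGaussian

theorem lintegral_comp_mul_exp {b : ℝ} (hb : 0 < b) (g : ℝ → ℝ≥0∞) :
    ∫⁻ y in Set.Ioi 0, g y = ∫⁻ w : ℝ, ENNReal.ofReal (b * Real.exp w) * g (b * Real.exp w) := by
  have h := lintegral_image_eq_lintegral_abs_deriv_mul (s := Set.univ)
    (f := fun w => b * Real.exp w) (f' := fun w => b * Real.exp w) MeasurableSet.univ
    (fun x _ => ((Real.hasDerivAt_exp x).const_mul b).hasDerivWithinAt)
    (fun x _ y _ hxy => Real.exp_injective (mul_left_cancel₀ hb.ne' hxy)) g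
  have hr : (fun w => b * Real.exp w) '' Set.univ = Set.Ioi 0 := by
    ext y
    simp only [Set.image_univ, Set.mem_range, Set.mem_Ioi]
    refine ⟨fun ⟨w, hw⟩ => hw ▸ mul_pos hb (Real.exp_pos w), fun hy =>
      ⟨Real.log (y / b), ?_⟩⟩
    rw [Real.exp_log (div_pos hy hb)]
    field_simp
  rw [hr, Measure.restrict_univ] at h
  rw [h]
  refine lintegral_congr fun w => ?_
  rw [abs_of_pos (mul_pos hb (Real.exp_pos w))]

theorem lintegral_comp_sinh (g : ℝ → ℝ≥0∞) :
    ∫⁻ z, g z = ∫⁻ w : ℝ, ENNReal.ofReal (Real.cosh (w / 2) / 2) * g (Real.sinh (w / 2)) := by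
  have h := lintegral_image_eq_lintegral_abs_deriv_mul (s := Set.univ)
    (f := fun w => Real.sinh (w / 2)) (f' := fun w => Real.cosh (w / 2) / 2) MeasurableSet.univ
    (fun x _ => by
      have := (Real.hasDerivAt_sinh (x / 2)).comp x ((hasDerivAt_id x).div_const 2)
      refine HasDerivAt.hasDerivWithinAt ?_
      convert! this using 1
      ring)
    (fun x _ y _ hxy => by
      have := Real.sinh_injective hxy
      linarith) g
  have hr : (fun w => Real.sinh (w / 2)) '' Set.univ = Set.univ := by
    rw [Set.image_univ, Set.range_eq_univ]
    intro z
    obtain ⟨w, hw⟩ := Real.sinh_surjective z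
    exact ⟨2 * w, by simpa using hw⟩
  rw [hr, Measure.restrict_univ] at h
  rw [h]
  refine lintegral_congr fun w => ?_
  rw [abs_of_pos (by have := Real.cosh_pos (w / 2); positivity)]

/-- The substitution `y = b e^w` gives the integrand `√b e^{w/2} e^{-b cosh w}`. Adding its
reflection in `w` replaces `e^{w/2}` by `2 cosh (w/2)`, which is four times the derivative of `z =
sinh (w/2)`. As `cosh w = 1 + 2 z²`, what remains is a Gaussian integral in `z`. -/
theorem lintegral_inverseGaussian_of_pos {b : ℝ} (hb : 0 < b) :
    ∫⁻ y in Set.Ioi 0, ENNReal.ofReal (Real.exp (-(y + b ^ 2 / y) / 2) / √y) =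
      ENNReal.ofReal (√(2 * Real.pi) * Real.exp (-b)) := by
  have hsb : 0 < √b := Real.sqrt_pos.2 hb
  have hsq : √b * √b = b := Real.mul_self_sqrt hb.le
  set J := ∫⁻ y in Set.Ioi 0, ENNReal.ofReal (Real.exp (-(y + b ^ 2 / y) / 2) / √y) with hJ
  have h1 : J = ∫⁻ w : ℝ, ENNReal.ofReal (√b * Real.exp (w / 2) *
      Real.exp (-(b * Real.cosh w))) := by
    rw [hJ, lintegral_comp_mul_exp hb]
    refine lintegral_congr fun w => ?_
    rw [← ENNReal.ofReal_mul (by positivity)]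
    congr 1
    have e1 : √(b * Real.exp w) = √b * Real.exp (w / 2) := by
      rw [Real.sqrt_mul hb.le, Real.exp_half]
    have e2 : Real.exp w = Real.exp (w / 2) * Real.exp (w / 2) := by
      rw [← Real.exp_add]; ring_nf
    have e3 : -(b * Real.exp w + b ^ 2 / (b * Real.exp w)) / 2 = -(b * Real.cosh w) := by
      rw [Real.cosh_eq, Real.exp_neg]
      field_simp
    rw [e3, e1]
    rw [mul_div_assoc', div_eq_iff (by positivity)]
    nth_rw 1 [e2]
    nth_rw 1 [← hsq]
    ring
  have h2 : J = ∫⁻ w : ℝ, ENNReal.ofReal (√b * Real.exp (-w / 2) *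
      Real.exp (-(b * Real.cosh w))) := by
    rw [h1, ← lintegral_neg_eq_self]
    refine lintegral_congr fun w => ?_
    rw [Real.cosh_neg]
  have h3 : J + J = ∫⁻ z : ℝ, ENNReal.ofReal (4 * √b * Real.exp (-b)) *
      ENNReal.ofReal (Real.exp (-(2 * b) * z ^ 2)) := by
    nth_rw 1 [h1]
    rw [h2, ← lintegral_add_left (by fun_prop), lintegral_comp_sinh (fun z =>
      ENNReal.ofReal (4 * √b * Real.exp (-b)) * ENNReal.ofReal (Real.exp (-(2 * b) * z ^ 2)))]
    refine lintegral_congr fun w => ?_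
    rw [← ENNReal.ofReal_add (by positivity) (by positivity), ← ENNReal.ofReal_mul (by positivity),
      ← ENNReal.ofReal_mul (by have := Real.cosh_pos (w / 2); positivity)]
    congr 1
    have e1 : Real.exp (-(b * Real.cosh w)) =
        Real.exp (-b) * Real.exp (-(2 * b) * Real.sinh (w / 2) ^ 2) := by
      rw [← Real.exp_add]
      congr 1
      have : Real.cosh w = 1 + 2 * Real.sinh (w / 2) ^ 2 := by
        have h := Real.cosh_two_mul (w / 2)
        rw [Real.cosh_sq, mul_div_cancel₀ _ two_ne_zero] at h
        rw [h]; ring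
      rw [this]
      ring
    rw [e1, Real.cosh_eq, neg_div]
    ring
  rw [lintegral_const_mul' _ _ ENNReal.ofReal_ne_top, lintegral_exp_neg_mul_sq (by positivity),
    ← ENNReal.ofReal_mul (by positivity)] at h3
  have h4 : 4 * √b * Real.exp (-b) * √(Real.pi / (2 * b)) =
      √(2 * Real.pi) * Real.exp (-b) + √(2 * Real.pi) * Real.exp (-b) := by
    have e1 : √(Real.pi / (2 * b)) = √(2 * Real.pi) / (2 * √b) := by
      rw [Real.sqrt_eq_iff_mul_self_eq_of_pos (by positivity), div_mul_div_comm,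
        Real.mul_self_sqrt (by positivity)]
      rw [div_eq_div_iff (by positivity) (by positivity)]
      linear_combination (-4 * Real.pi) * hsq
    rw [e1]
    field_simp
    ring
  rw [h4, ENNReal.ofReal_add (by positivity) (by positivity), ← two_mul, ← two_mul] at h3
  exact (ENNReal.mul_right_inj two_ne_zero ENNReal.ofNat_ne_top).1 h3

theorem lintegral_inverseGaussian {b : ℝ} (hb : 0 ≤ b) :
    ∫⁻ y in Set.Ioi 0, ENNReal.ofReal (Real.exp (-(y + b ^ 2 / y) / 2) / √y) =
      ENNReal.ofReal (√(2 * Real.pi) * Real.exp (-b)) := by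
  rcases hb.eq_or_lt with rfl | hb
  -- For `b = 0` the substitution degenerates, and the integral is a value of the Gamma function at
  -- 1/2.
  · have h := Real.integral_rpow_mul_exp_neg_mul_Ioi (a := 1 / 2) (r := 1 / 2)
      (by norm_num) (by norm_num)
    have hg : ∀ y ∈ Set.Ioi (0 : ℝ), Real.exp (-(y + 0 ^ 2 / y) / 2) / √y =
        y ^ ((1 / 2 : ℝ) - 1) * Real.exp (-(1 / 2 * y)) := by
      intro y hy
      have hy' : (0 : ℝ) < y := hy
      have e : y ^ ((1 / 2 : ℝ) - 1) = (√y)⁻¹ := by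
        rw [Real.sqrt_eq_rpow, ← Real.rpow_neg hy'.le]
        norm_num
      rw [e, div_eq_inv_mul]
      congr 2
      ring
    have hint : √(2 * Real.pi) =
        ∫ y in Set.Ioi (0 : ℝ), y ^ ((1 / 2 : ℝ) - 1) * Real.exp (-(1 / 2 * y)) := by
      rw [h, Real.Gamma_one_half_eq, ← Real.sqrt_eq_rpow, ← Real.sqrt_mul (by norm_num)]
      norm_num
    have hpos : 0 < √(2 * Real.pi) := by positivity
    rw [setLIntegral_congr_fun measurableSet_Ioi fun y hy => congrArg ENNReal.ofReal (hg y hy),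
      neg_zero, Real.exp_zero, mul_one, hint, ofReal_integral_eq_lintegral_ofReal]
    -- Integrability comes for free: the Bochner integral of a non-integrable function is 0 by
    -- convention, whereas this one is `√(2π) > 0`.
    · by_contra hni
      rw [hint, integral_undef hni] at hpos
      exact lt_irrefl _ hpos
    · rw [Filter.EventuallyLE, ae_restrict_iff' measurableSet_Ioi]
      refine ae_of_all _ fun y hy => ?_
      have hy' : (0 : ℝ) < y := hy
      simp only [Pi.zero_apply]
      positivity
  · exact lintegral_inverseGaussian_of_pos hb

end InverseGaussian

/-! ### Inverse nonnegativity and the density of the random Schrödinger operator -/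

section MMatrix

variable {n : Type*} [Fintype n] [DecidableEq n]

/-- A positive definite matrix with nonpositive off-diagonal entries is inverse nonnegative. -/
theorem nonneg_of_mulVec_nonneg {A : Matrix n n ℝ} (hA : A.PosDef)
    (hoff : ∀ i j, i ≠ j → A i j ≤ 0) {x : n → ℝ} (hx : ∀ i, 0 ≤ A.mulVec x i) (i : n) :
    0 ≤ x i := by
  -- `p` is the negative part of `x` and `x + p` the positive part. Their supports are disjoint, so
  -- `p · A (x + p)` involves off-diagonal entries only and is at most 0. This contradicts `p · A x
  -- ≥ 0` and `p · A p > 0`.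
  set p : n → ℝ := fun i => max (-x i) 0 with hp
  have hp0 : ∀ i, 0 ≤ p i := fun i => le_max_right _ _
  have hxp : ∀ i, 0 ≤ x i + p i := fun i => by
    have := le_max_left (-x i) 0
    simp only [hp]
    linarith
  have hzero : ∀ i, p i * (x i + p i) = 0 := fun i => by
    rcases le_total (x i) 0 with h | h
    · simp [hp, max_eq_left (neg_nonneg.2 h)]
    · simp [hp, max_eq_right (neg_nonpos.2 h)]
  by_contra hneg
  have hpne : p ≠ 0 := fun h => by
    have h1 := congrFun h i
    have h2 := le_max_left (-x i) 0
    simp only [hp, Pi.zero_apply] at h1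
    linarith
  have h1 := hA.dotProduct_mulVec_pos hpne
  rw [star_trivial] at h1
  have h2 : 0 ≤ p ⬝ᵥ A.mulVec x :=
    Finset.sum_nonneg fun i _ => mul_nonneg (hp0 i) (hx i)
  have h3 : p ⬝ᵥ A.mulVec (x + p) ≤ 0 := by
    simp only [dotProduct, Matrix.mulVec, Finset.mul_sum]
    refine Finset.sum_nonpos fun i _ => Finset.sum_nonpos fun j _ => ?_
    by_cases hij : i = j
    · subst hij
      have : p i * (A i i * (x + p) i) = A i i * (p i * (x i + p i)) := by
        simp only [Pi.add_apply]; ring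
      rw [this, hzero, mul_zero]
    · exact mul_nonpos_of_nonneg_of_nonpos (hp0 i)
        (mul_nonpos_of_nonpos_of_nonneg (hoff i j hij) (hxp j))
  rw [Matrix.mulVec_add, dotProduct_add] at h3
  linarith

omit [DecidableEq n] in
theorem isClosed_setOf_posSemidef : IsClosed {A : Matrix n n ℝ | A.PosSemidef} := by
  have : {A : Matrix n n ℝ | A.PosSemidef} =
      {A : Matrix n n ℝ | A.conjTranspose = A} ∩ ⋂ x : n → ℝ, {A | 0 ≤ star x ⬝ᵥ A.mulVec x} := by
    ext A
    simp only [Set.mem_ofPred_eq, Set.mem_inter_iff, Set.mem_iInter,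
      Matrix.posSemidef_iff_dotProduct_mulVec]
    rfl
  rw [this]
  refine IsClosed.inter (isClosed_eq (by fun_prop) continuous_id)
    (isClosed_iInter fun x => isClosed_le continuous_const ?_)
  exact Continuous.dotProduct continuous_const (Continuous.matrix_mulVec continuous_id
    continuous_const)

/-- Positive definite means positive semidefinite, a closed condition, with nonzero determinant, an
open one. -/
theorem measurableSet_setOf_diagonal_sub_posDef (W : Matrix n n ℝ) :
    MeasurableSet {a : n → ℝ | (Matrix.diagonal a - W).PosDef} := by
  have hc : Continuous fun a : n → ℝ => Matrix.diagonal a - W :=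
    (Continuous.matrix_diagonal continuous_id).sub continuous_const
  have : {a : n → ℝ | (Matrix.diagonal a - W).PosDef} =
      {a | (Matrix.diagonal a - W).PosSemidef} ∩ {a | (Matrix.diagonal a - W).det = 0}ᶜ := by
    ext a
    refine ⟨fun h => ⟨h.posSemidef, h.det_pos.ne'⟩, fun h => ?_⟩
    exact h.1.posDef_iff_det_ne_zero.2 h.2
  rw [this]
  refine (isClosed_setOf_posSemidef.preimage hc).measurableSet.inter
    (isClosed_eq hc.matrix_det continuous_const).measurableSet.compl

/-- The exponential factor of the density of the random Schrödinger operator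
`H = diagonal a - W`. -/
noncomputable def schroedingerWeight (H : Matrix n n ℝ) (η : n → ℝ) : ℝ :=
  Real.exp (-((fun _ => 1) ⬝ᵥ H.mulVec fun _ => 1) / 2 - (η ⬝ᵥ H⁻¹.mulVec η) / 2 + ∑ i, η i)

open Classical in
/-- The density of the random Schrödinger operator `H = diagonal a - W`, up to a constant. -/
noncomputable def schroedingerDensity (W : Matrix n n ℝ) (η a : n → ℝ) : ℝ≥0∞ :=
  if (Matrix.diagonal a - W).PosDef then
    ENNReal.ofReal (schroedingerWeight (Matrix.diagonal a - W) η /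
      √(Matrix.diagonal a - W).det) else 0

theorem measurable_schroedingerDensity (W : Matrix n n ℝ) (η : n → ℝ) :
    Measurable (schroedingerDensity W η) := by
  have hc : Continuous fun a : n → ℝ => Matrix.diagonal a - W :=
    (Continuous.matrix_diagonal continuous_id).sub continuous_const
  refine Measurable.ite (measurableSet_setOf_diagonal_sub_posDef W) ?_ measurable_const
  refine ENNReal.measurable_ofReal.comp (Measurable.div ?_ ?_)
  · refine Real.measurable_exp.comp ((Measurable.sub ?_ (Measurable.div_const ?_ _)).add_const _)
    · refine Measurable.div_const (Measurable.neg (Continuous.measurable ?_)) _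
      exact Continuous.dotProduct continuous_const (hc.matrix_mulVec continuous_const)
    · have : (fun a : n → ℝ => η ⬝ᵥ (Matrix.diagonal a - W)⁻¹.mulVec η) = fun a =>
          ((Matrix.diagonal a - W).det)⁻¹ * (η ⬝ᵥ (Matrix.diagonal a - W).adjugate.mulVec η) := by
        funext a
        rw [Matrix.inv_def, Ring.inverse_eq_inv', Matrix.smul_mulVec, dotProduct_smul, smul_eq_mul]
      rw [this]
      refine (Measurable.inv hc.matrix_det.measurable).mul (Continuous.measurable ?_)
      exact Continuous.dotProduct continuous_const (hc.matrix_adjugate.matrix_mulVec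
        continuous_const)
  · exact (Real.continuous_sqrt.comp hc.matrix_det).measurable

end MMatrix

/-! ### Adding one vertex: Schur complements -/

section Schur

variable {n : Type*} [Fintype n] [DecidableEq n]

/-- The matrix obtained from `A` by adding one row and one column. -/
def border (A : Matrix n n ℝ) (w : n → ℝ) (t : ℝ) : Matrix (n ⊕ Unit) (n ⊕ Unit) ℝ :=
  Matrix.fromBlocks A (Matrix.of fun i _ => -w i) (Matrix.of fun _ i => -w i)
    (Matrix.of fun _ _ => t)

theorem det_border {A : Matrix n n ℝ} (hA : A.PosDef) (w : n → ℝ) (t : ℝ) :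
    (border A w t).det = A.det * (t - w ⬝ᵥ A⁻¹.mulVec w) := by
  have := hA.isUnit.invertible
  rw [border, Matrix.det_fromBlocks₁₁, Matrix.det_unique (n := Unit), Matrix.invOf_eq_nonsing_inv]
  congr 1
  have h : ((Matrix.of fun (_ : Unit) i => -w i) * A⁻¹ * (Matrix.of fun i (_ : Unit) => -w i))
      default default = w ⬝ᵥ A⁻¹.mulVec w := by
    rw [Matrix.mul_assoc, Matrix.mul_apply, dotProduct]
    refine Finset.sum_congr rfl fun i _ => ?_
    rw [Matrix.mul_apply, Matrix.mulVec, dotProduct, Matrix.of_apply]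
    simp
  rw [Matrix.sub_apply, h, Matrix.of_apply]

/-- A positive Schur complement makes the bordered matrix positive semidefinite, and its
determinant, being `det A` times this complement, is nonzero. -/
theorem border_posDef_iff {A : Matrix n n ℝ} (hA : A.PosDef) (w : n → ℝ) (t : ℝ) :
    (border A w t).PosDef ↔ 0 < t - w ⬝ᵥ A⁻¹.mulVec w := by
  have := hA.isUnit.invertible
  refine ⟨fun h => ?_, fun h => ?_⟩
  · have := h.det_pos
    rw [det_border hA] at this
    exact pos_of_mul_pos_right this hA.det_pos.le
  · have hps : (border A w t).PosSemidef := by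
      have hB : (Matrix.of fun (_ : Unit) i => -w i) =
          (Matrix.of fun i (_ : Unit) => -w i).conjTranspose := by
        ext i j
        simp
      rw [border, hB, hA.fromBlocks₁₁]
      have h1 : (Matrix.of fun (_ _ : Unit) => t) -
          (Matrix.of fun i (_ : Unit) => -w i).conjTranspose
          * A⁻¹ * (Matrix.of fun i (_ : Unit) => -w i) =
          Matrix.diagonal fun _ : Unit => (t - w ⬝ᵥ A⁻¹.mulVec w) := by
        ext i j
        rw [Matrix.sub_apply, Matrix.mul_assoc, Matrix.mul_apply, dotProduct, Matrix.of_apply,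
          Subsingleton.elim i j, Matrix.diagonal_apply_eq]
        congr 1
        refine Finset.sum_congr rfl fun i _ => ?_
        rw [Matrix.mul_apply, Matrix.mulVec, dotProduct]
        simp
      rw [h1]
      exact Matrix.PosSemidef.diagonal fun _ => h.le
    rw [hps.posDef_iff_det_ne_zero, det_border hA]
    exact (mul_pos hA.det_pos h).ne'

omit [Fintype n] [DecidableEq n] in
theorem posDef_of_border {A : Matrix n n ℝ} {w : n → ℝ} {t : ℝ} (h : (border A w t).PosDef) :
    A.PosDef :=
  h.submatrix (e := Sum.inl) Sum.inl_injective

omit [DecidableEq n] in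
theorem border_mulVec (A : Matrix n n ℝ) (w x : n → ℝ) (t r : ℝ) :
    (border A w t).mulVec (Sum.elim x fun _ => r) =
      Sum.elim (A.mulVec x - r • w) fun _ => t * r - w ⬝ᵥ x := by
  rw [border, Matrix.fromBlocks_mulVec]
  congr 1
  · funext i
    simp [Matrix.mulVec, dotProduct]
    ring
  · funext i
    simp [Matrix.mulVec, dotProduct]
    ring

/-- Here `y` is the Schur complement and `b = s + w · A⁻¹ η`. The cross terms of `⟨1, H 1⟩` supply
the `∑ w` that the weight with `η + w` needs. The terms `w · A⁻¹ w` and `2 w · A⁻¹ η` complete its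
quadratic form, at the price of the factor `e^b`, which later cancels the `e^{-b}` of the inverse
Gaussian integral. -/
theorem schroedingerWeight_border {A : Matrix n n ℝ} (hA : A.PosDef) (w η : n → ℝ) (s y : ℝ)
    (hy : 0 < y) :
    schroedingerWeight (border A w (y + w ⬝ᵥ A⁻¹.mulVec w)) (Sum.elim η fun _ => s) =
      schroedingerWeight A (η + w) * Real.exp (s + w ⬝ᵥ A⁻¹.mulVec η) *
        Real.exp (-(y + (s + w ⬝ᵥ A⁻¹.mulVec η) ^ 2 / y) / 2) := by
  set H := border A w (y + w ⬝ᵥ A⁻¹.mulVec w) with hH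
  have hu : IsUnit A.det := (Matrix.isUnit_iff_isUnit_det _).1 hA.isUnit
  have hHp : H.PosDef := (border_posDef_iff hA w _).2 (by simpa using hy)
  have hHu : IsUnit H.det := (Matrix.isUnit_iff_isUnit_det _).1 hHp.isUnit
  set z := A⁻¹.mulVec η with hz
  set v := A⁻¹.mulVec w with hv
  set b := s + w ⬝ᵥ z with hb
  have hAz : A.mulVec z = η := by
    rw [hz, Matrix.mulVec_mulVec, Matrix.mul_nonsing_inv _ hu, Matrix.one_mulVec]
  have hAv : A.mulVec v = w := by
    rw [hv, Matrix.mulVec_mulVec, Matrix.mul_nonsing_inv _ hu, Matrix.one_mulVec]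
  have hsymm : η ⬝ᵥ v = w ⬝ᵥ z := by
    have hT : A⁻¹.transpose = A⁻¹ := by
      have := hA.inv.isHermitian
      rwa [Matrix.IsHermitian, Matrix.conjTranspose_eq_transpose_of_trivial] at this
    rw [hv, Matrix.dotProduct_mulVec, ← Matrix.mulVec_transpose, hT, dotProduct_comm]
  -- Block elimination: the last coordinate of the solution is `b / y`, and the others follow from
  -- the first block of equations.
  have hinv : H⁻¹.mulVec (Sum.elim η fun _ => s) =
      Sum.elim (z + (b / y) • v) fun _ => b / y := by
    have h1 : H.mulVec (Sum.elim (z + (b / y) • v) fun _ => b / y) = Sum.elim η fun _ => s := by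
      rw [hH, border_mulVec, Matrix.mulVec_add, Matrix.mulVec_smul, hAz, hAv, add_sub_cancel_right]
      congr 1
      funext _
      rw [dotProduct_add, dotProduct_smul, smul_eq_mul, hb]
      field_simp
      ring
    rw [← h1, Matrix.mulVec_mulVec, Matrix.nonsing_inv_mul _ hHu, Matrix.one_mulVec]
  have h1 : (Sum.elim η fun _ => s) ⬝ᵥ H⁻¹.mulVec (Sum.elim η fun _ => s) =
      η ⬝ᵥ z + b ^ 2 / y := by
    rw [hinv, sumElim_dotProduct_sumElim, dotProduct_add, dotProduct_smul, hsymm]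
    simp only [dotProduct, Finset.univ_unique, Finset.sum_singleton, smul_eq_mul]
    simp only [hb, dotProduct]
    ring
  have h2 : ((fun _ => 1) ⬝ᵥ H.mulVec fun _ => 1 : ℝ) =
      ((fun _ => 1) ⬝ᵥ A.mulVec fun _ => 1) - 2 * ∑ i, w i + (y + w ⬝ᵥ v) := by
    have e : (fun _ : n ⊕ Unit => (1 : ℝ)) = Sum.elim (fun _ => 1) fun _ => 1 := by
      funext i
      cases i <;> rfl
    rw [e, hH, border_mulVec, sumElim_dotProduct_sumElim, dotProduct_sub]
    simp only [dotProduct, Finset.univ_unique, Finset.sum_singleton, one_smul, mul_one, one_mul]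
    ring
  have h3 : (η + w) ⬝ᵥ A⁻¹.mulVec (η + w) = η ⬝ᵥ z + 2 * (w ⬝ᵥ z) + w ⬝ᵥ v := by
    rw [Matrix.mulVec_add, add_dotProduct, dotProduct_add, dotProduct_add, ← hz, ← hv, hsymm]
    ring
  rw [schroedingerWeight, schroedingerWeight, h1, h2, h3, ← Real.exp_add, ← Real.exp_add]
  congr 1
  simp only [Fintype.sum_sum_type, Sum.elim_inl, Sum.elim_inr, Pi.add_apply,
    Finset.sum_add_distrib, Finset.univ_unique, Finset.sum_singleton]
  rw [hb]
  ring

end Schur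

/-! ### Total mass of the random Schrödinger operator -/

section SchroedingerIntegral

theorem lintegral_sum_unit {n : Type*} [Fintype n] {f : (n ⊕ Unit → ℝ) → ℝ≥0∞}
    (hf : Measurable f) :
    ∫⁻ a, f a = ∫⁻ a : n → ℝ, ∫⁻ t : ℝ, f (Sum.elim a fun _ => t) := by
  have h1 := (volume_measurePreserving_sumPiEquivProdPi_symm
    (fun _ : n ⊕ Unit => ℝ)).lintegral_comp hf
  rw [← h1, Measure.volume_eq_prod, lintegral_prod]
  · refine lintegral_congr fun a => ?_
    have h2 := (volume_preserving_funUnique Unit ℝ).symm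
    rw [← h2.lintegral_comp_emb (MeasurableEquiv.measurableEmbedding _)]
    refine lintegral_congr fun t => ?_
    rfl
  · exact (hf.comp (MeasurableEquiv.measurable _)).aemeasurable

theorem diagonal_sub_eq_border {n : Type*} [DecidableEq n] {W : Matrix (n ⊕ Unit) (n ⊕ Unit) ℝ}
    (hW : W.IsSymm) (a : n → ℝ) (t : ℝ) :
    Matrix.diagonal (Sum.elim a fun _ => t) - W =
      border (Matrix.diagonal a - W.toBlocks₁₁) (fun i => W (Sum.inl i) (Sum.inr ()))
        (t - W (Sum.inr ()) (Sum.inr ())) := by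
  ext i j
  rcases i with i | i <;> rcases j with j | j
  · simp [border, Matrix.diagonal_apply, Matrix.toBlocks₁₁]
  · simp [border]
  · simp [border, hW.apply (Sum.inl j) (Sum.inr ())]
  · simp [border]

/-- Integrates out the diagonal entry of one vertex. A general `η ≥ 0` is needed because the removed
column of `W` is added to it, so that the family of integrals is closed under this step. -/
theorem lintegral_schroedingerDensity_sum_unit {n : Type*} [Fintype n] [DecidableEq n]
    {W : Matrix (n ⊕ Unit) (n ⊕ Unit) ℝ} (hW : W.IsSymm) (hW0 : ∀ i j, 0 ≤ W i j)
    {η : n ⊕ Unit → ℝ} (hη : ∀ i, 0 ≤ η i) :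
    ∫⁻ a, schroedingerDensity W η a =
      ENNReal.ofReal √(2 * Real.pi) * ∫⁻ a, schroedingerDensity W.toBlocks₁₁
        ((fun i => η (Sum.inl i)) + fun i => W (Sum.inl i) (Sum.inr ())) a := by
  rw [lintegral_sum_unit (measurable_schroedingerDensity W η),
    ← lintegral_const_mul' _ _ ENNReal.ofReal_ne_top]
  refine lintegral_congr fun a => ?_
  set w : n → ℝ := fun i => W (Sum.inl i) (Sum.inr ()) with hw
  set A := Matrix.diagonal a - W.toBlocks₁₁ with hAdef
  set η' : n → ℝ := fun i => η (Sum.inl i) with hη'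
  have hηe : η = Sum.elim η' fun _ => η (Sum.inr ()) := by
    funext i
    rcases i with i | i <;> rfl
  by_cases hA : A.PosDef
  · rw [schroedingerDensity, if_pos hA]
    set k := W (Sum.inr ()) (Sum.inr ()) + w ⬝ᵥ A⁻¹.mulVec w with hk
    set b := η (Sum.inr ()) + w ⬝ᵥ A⁻¹.mulVec η' with hb
    have hu : IsUnit A.det := (Matrix.isUnit_iff_isUnit_det _).1 hA.isUnit
    -- The inverse Gaussian formula requires `b ≥ 0`; this holds because `A⁻¹` preserves nonnegative
    -- vectors.
    have hb0 : 0 ≤ b := by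
      refine add_nonneg (hη _) (Finset.sum_nonneg fun i _ => mul_nonneg (hW0 _ _) ?_)
      refine nonneg_of_mulVec_nonneg hA (fun i j hij => ?_) (fun i => ?_) i
      · simp [hAdef, Matrix.diagonal_apply_ne _ hij, Matrix.toBlocks₁₁, hW0]
      · rw [Matrix.mulVec_mulVec, Matrix.mul_nonsing_inv _ hu, Matrix.one_mulVec]
        exact hη _
    have hs : 0 ≤ schroedingerWeight A (η' + w) := (Real.exp_pos _).le
    -- After this translation the integration variable is the Schur complement, and positive
    -- definiteness of the full matrix reads `0 < y`.
    rw [← lintegral_add_right_eq_self _ k]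
    have hint : ∀ y : ℝ, schroedingerDensity W η (Sum.elim a fun _ => y + k) =
        (Set.Ioi (0 : ℝ)).indicator (fun y => ENNReal.ofReal (schroedingerWeight A (η' + w) *
          Real.exp b / √A.det) * ENNReal.ofReal (Real.exp (-(y + b ^ 2 / y) / 2) / √y)) y := by
      intro y
      have hH : Matrix.diagonal (Sum.elim a fun _ => y + k) - W =
          border A w (y + w ⬝ᵥ A⁻¹.mulVec w) := by
        rw [diagonal_sub_eq_border hW, ← hAdef, ← hw, hk]
        congr 1
        ring
      have hiff := border_posDef_iff hA w (y + w ⬝ᵥ A⁻¹.mulVec w)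
      rw [add_sub_cancel_right, ← hH] at hiff
      by_cases hy : 0 < y
      · rw [schroedingerDensity, if_pos (hiff.2 hy), Set.indicator_of_mem (Set.mem_Ioi.2 hy), hH,
          det_border hA, add_sub_cancel_right, hηe, schroedingerWeight_border hA _ _ _ _ hy,
          ← ENNReal.ofReal_mul (by positivity), Real.sqrt_mul hA.det_pos.le, ← hb,
          div_mul_div_comm]
      · rw [schroedingerDensity, if_neg (fun h => hy (hiff.1 h)),
          Set.indicator_of_notMem (by simpa using hy)]
    rw [lintegral_congr hint, lintegral_indicator measurableSet_Ioi,
      lintegral_const_mul' _ _ ENNReal.ofReal_ne_top, lintegral_inverseGaussian hb0,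
      ← ENNReal.ofReal_mul (by positivity), ← ENNReal.ofReal_mul (by positivity)]
    congr 1
    rw [Real.exp_neg]
    field_simp
    rfl
  -- A principal submatrix of a positive definite matrix is positive definite, so both sides vanish
  -- when `A` fails to be.
  · rw [schroedingerDensity, if_neg hA, mul_zero]
    have : ∀ t : ℝ, schroedingerDensity W η (Sum.elim a fun _ => t) = 0 := fun t => by
      rw [schroedingerDensity, if_neg]
      rw [diagonal_sub_eq_border hW]
      exact fun h => hA (posDef_of_border h)
    simp [this]

theorem lintegral_schroedingerDensity_equiv {m n : Type*} [Fintype m] [DecidableEq m] [Fintype n]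
    [DecidableEq n] (e : m ≃ n) (W : Matrix n n ℝ) (η : n → ℝ) :
    ∫⁻ a, schroedingerDensity W η a =
      ∫⁻ a, schroedingerDensity (W.submatrix e e) (η ∘ e) a := by
  have h := (volume_measurePreserving_piCongrLeft (fun _ : n => ℝ) e).lintegral_comp
    (measurable_schroedingerDensity W η)
  rw [← h]
  refine lintegral_congr fun a => ?_
  set a' := MeasurableEquiv.piCongrLeft (fun _ : n => ℝ) e a with ha'
  have ha : a = a' ∘ e := by
    funext i
    rw [ha', Function.comp_apply, MeasurableEquiv.coe_piCongrLeft, Equiv.piCongrLeft_apply_apply]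
  have hH : Matrix.diagonal a - W.submatrix e e = (Matrix.diagonal a' - W).submatrix e e := by
    rw [Matrix.submatrix_sub, Pi.sub_apply, Pi.sub_apply, Matrix.submatrix_diagonal_equiv, ha]
  set H := Matrix.diagonal a' - W with hHdef
  have hpos : (H.submatrix e e).PosDef ↔ H.PosDef := by
    refine ⟨fun h => ?_, fun h => h.submatrix e.injective⟩
    have := h.submatrix (e := e.symm) e.symm.injective
    simpa using this
  have hw : schroedingerWeight (H.submatrix e e) (η ∘ e) = schroedingerWeight H η := by
    rw [schroedingerWeight, schroedingerWeight, Matrix.inv_submatrix_equiv]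
    have h1 : ∀ (M : Matrix n n ℝ) (x y : n → ℝ),
        (x ∘ e) ⬝ᵥ (M.submatrix e e).mulVec (y ∘ e) = x ⬝ᵥ M.mulVec y := by
      intro M x y
      rw [Matrix.submatrix_mulVec_equiv, Function.comp_assoc, Equiv.self_comp_symm,
        Function.comp_id, comp_equiv_dotProduct_comp_equiv]
    have h2 := h1 H (fun _ => 1) (fun _ => 1)
    have h3 : (fun _ : n => (1 : ℝ)) ∘ e = fun _ => 1 := rfl
    rw [h3] at h2
    rw [h1, h2, ← Equiv.sum_comp e]
    rfl
  by_cases hp : H.PosDef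
  · rw [schroedingerDensity, schroedingerDensity, if_pos hp, hH, if_pos (hpos.2 hp), hw,
      Matrix.det_submatrix_equiv_self]
  · rw [schroedingerDensity, schroedingerDensity, if_neg hp, hH, if_neg fun h => hp (hpos.1 h)]

/-- `W` and `η` are quantified inside the induction because both change when a vertex is removed. -/
theorem lintegral_schroedingerDensity_fin (k : ℕ) : ∀ {W : Matrix (Fin k) (Fin k) ℝ},
    W.IsSymm → (∀ i j, 0 ≤ W i j) → ∀ {η : Fin k → ℝ}, (∀ i, 0 ≤ η i) →
    ∫⁻ a, schroedingerDensity W η a = ENNReal.ofReal (√(2 * Real.pi) ^ k) := by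
  induction k with
  | zero =>
    intro W _ _ η _
    have h : ∀ a, schroedingerDensity W η a = 1 := by
      intro a
      rw [schroedingerDensity, if_pos]
      · simp [schroedingerWeight, dotProduct]
      · refine Matrix.PosDef.of_dotProduct_mulVec_pos (Subsingleton.elim _ _) fun {x} hx => ?_
        exact absurd (Subsingleton.elim _ _) hx
    simp [h, volume_pi]
  | succ k ih =>
    intro W hW hW0 η hη
    let e : Fin k ⊕ Unit ≃ Fin (k + 1) := Fintype.equivOfCardEq (by simp)
    rw [lintegral_schroedingerDensity_equiv e, lintegral_schroedingerDensity_sum_unit, ih,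
      ← ENNReal.ofReal_mul (by positivity), pow_succ']
    · ext i j
      exact hW.apply _ _
    · intro i j
      exact hW0 _ _
    · intro i
      exact add_nonneg (hη _) (hW0 _ _)
    · ext i j
      exact hW.apply _ _
    · intro i j
      exact hW0 _ _
    · intro i
      exact hη _

/-- The total mass of the law of the random Schrödinger operator. -/
theorem lintegral_schroedingerDensity {n : Type*} [Fintype n] [DecidableEq n] {W : Matrix n n ℝ}
    (hW : W.IsSymm) (hW0 : ∀ i j, 0 ≤ W i j) {η : n → ℝ} (hη : ∀ i, 0 ≤ η i) :
    ∫⁻ a, schroedingerDensity W η a = ENNReal.ofReal (√(2 * Real.pi) ^ Fintype.card n) := by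
  rw [lintegral_schroedingerDensity_equiv (Fintype.equivFin n).symm]
  refine lintegral_schroedingerDensity_fin _ ?_ (fun _ _ => hW0 _ _) (fun _ => hη _)
  ext i j
  exact hW.apply _ _

end SchroedingerIntegral

/-! ### From the field `u` to the Schrödinger potential -/

section FieldCoordinates

variable {V : Type*} [Fintype V] [DecidableEq V]

theorem extendZero_coe {V : Type*} [DecidableEq V] (i₀ : V) (x : {i : V // i ≠ i₀} → ℝ)
    (i : {i : V // i ≠ i₀}) : (extendZero i₀ x : V → ℝ) i = x i := by
  simp [extendZero, i.2]

theorem extendZero_self {V : Type*} [DecidableEq V] (i₀ : V) (x : {i : V // i ≠ i₀} → ℝ) :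
    (extendZero i₀ x : V → ℝ) i₀ = 0 :=
  (extendZero i₀ x).2

theorem sum_eq_add_sum_ne (i₀ : V) (f : V → ℝ) :
    ∑ k, f k = f i₀ + ∑ i : {i : V // i ≠ i₀}, f i := by
  rw [← Finset.sum_subtype (Finset.univ.erase i₀) (p := fun j => j ≠ i₀) (by simp) f,
    Finset.add_sum_erase _ _ (Finset.mem_univ _)]

variable (G : SimpleGraph V) [DecidableRel G.Adj] (W : Sym2 V → ℝ) (i₀ : V)

/-- The weight of a pair of vertices, zero if they are not adjacent. -/
def pairWeight (G : SimpleGraph V) [DecidableRel G.Adj] (W : Sym2 V → ℝ) (k l : V) : ℝ :=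
  if G.Adj k l then W s(k, l) else 0

/-- The weight matrix on the vertices different from `i₀`. -/
def weightMatrix : Matrix {i : V // i ≠ i₀} {i : V // i ≠ i₀} ℝ :=
  Matrix.of fun i j => pairWeight G W i j

/-- The potential `∑_k W_ik e^{u_k - u_i}` of the random Schrödinger operator. -/
noncomputable def fieldPotential (u : {i : V // i ≠ i₀} → ℝ) (i : {i : V // i ≠ i₀}) : ℝ :=
  ∑ k, pairWeight G W i k * Real.exp ((extendZero i₀ u : V → ℝ) k - u i)

omit [Fintype V] [DecidableEq V] in
theorem pairWeight_comm (k l : V) : pairWeight G W k l = pairWeight G W l k := by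
  simp only [pairWeight, G.adj_comm k l, Sym2.eq_swap (a := k) (b := l)]

omit [Fintype V] [DecidableEq V] in
variable {G W} in
theorem pairWeight_nonneg (hW : ∀ e ∈ G.edgeSet, 0 < W e) (k l : V) : 0 ≤ pairWeight G W k l := by
  rw [pairWeight]
  split_ifs with h
  · exact (hW _ h).le
  · exact le_rfl

/-- A ground state transform: conjugating the Schrödinger operator by `e^u` gives the Laplacian with
conductances `W_ij e^{u_i + u_j}`. Positivity and determinants pass between the two through this
identity. -/
theorem diagonal_mul_mul_diagonal (u : {i : V // i ≠ i₀} → ℝ) :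
    Matrix.diagonal (fun i => Real.exp (u i)) *
      (Matrix.diagonal (fieldPotential G W i₀ u) - weightMatrix G W i₀) *
      Matrix.diagonal (fun i => Real.exp (u i)) =
    reducedLaplacian G (fun e => W e * Real.exp (edgeSum (extendZero i₀ u : V → ℝ) e)) i₀ := by
  ext i j
  rw [Matrix.mul_diagonal, Matrix.diagonal_mul, Matrix.sub_apply, reducedLaplacian_apply]
  have h1 : (if G.Adj i j then W s(↑i, ↑j) *
      Real.exp (edgeSum (extendZero i₀ u : V → ℝ) s(↑i, ↑j)) else 0) =
      Real.exp (u i) * weightMatrix G W i₀ i j * Real.exp (u j) := by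
    simp only [weightMatrix, Matrix.of_apply, pairWeight, edgeSum, Sym2.lift_mk, extendZero_coe]
    split_ifs
    · rw [Real.exp_add]; ring
    · ring
  rw [h1, mul_sub, sub_mul]
  congr 1
  by_cases hij : i = j
  · subst hij
    rw [Matrix.diagonal_apply_eq, if_pos rfl, fieldPotential, Finset.mul_sum, Finset.sum_mul]
    refine Finset.sum_congr rfl fun k _ => ?_
    simp only [pairWeight, edgeSum, Sym2.lift_mk, extendZero_coe]
    split_ifs
    · rw [Real.exp_sub, Real.exp_add]
      field_simp
    · ring
  · rw [Matrix.diagonal_apply_ne _ hij, if_neg hij]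
    ring

theorem det_diagonal_sub_mul (u : {i : V // i ≠ i₀} → ℝ) :
    (reducedLaplacian G (fun e => W e * Real.exp (edgeSum (extendZero i₀ u : V → ℝ) e)) i₀).det =
      (Matrix.diagonal (fieldPotential G W i₀ u) - weightMatrix G W i₀).det *
        Real.exp (∑ i, u i) ^ 2 := by
  rw [← diagonal_mul_mul_diagonal, Matrix.det_mul, Matrix.det_mul, Matrix.det_diagonal,
    ← Real.exp_sum]
  ring

variable {G W} in
theorem diagonal_fieldPotential_sub_posDef (hG : G.Connected) (hW : ∀ e ∈ G.edgeSet, 0 < W e)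
    (u : {i : V // i ≠ i₀} → ℝ) :
    (Matrix.diagonal (fieldPotential G W i₀ u) - weightMatrix G W i₀).PosDef := by
  have hu : IsUnit (Matrix.diagonal fun i => Real.exp (u i)) := by
    rw [Matrix.isUnit_iff_isUnit_det, Matrix.det_diagonal]
    exact (Finset.prod_pos fun i _ => Real.exp_pos _).ne'.isUnit
  rw [← Matrix.IsUnit.posDef_star_left_conjugate_iff hu]
  have hs : star (Matrix.diagonal fun i => Real.exp (u i)) =
      Matrix.diagonal fun i => Real.exp (u i) := by
    rw [Matrix.star_eq_conjTranspose, Matrix.diagonal_conjTranspose]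
    rfl
  rw [hs, diagonal_mul_mul_diagonal]
  exact reducedLaplacian_posDef G hG _ (fun e he => mul_pos (hW e he) (Real.exp_pos _)) i₀

theorem diagonal_sub_mulVec (a x : {i : V // i ≠ i₀} → ℝ) (i : {i : V // i ≠ i₀}) :
    (Matrix.diagonal a - weightMatrix G W i₀).mulVec x i =
      a i * x i - ∑ j : {j : V // j ≠ i₀}, pairWeight G W i j * x j := by
  rw [Matrix.sub_mulVec, Pi.sub_apply, Matrix.mulVec_diagonal]
  rfl

theorem fieldPotential_mul_exp (u : {i : V // i ≠ i₀} → ℝ) (i : {i : V // i ≠ i₀}) :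
    fieldPotential G W i₀ u i * Real.exp (u i) = pairWeight G W i i₀ +
      ∑ j : {j : V // j ≠ i₀}, pairWeight G W i j * Real.exp (u j) := by
  rw [fieldPotential, Finset.sum_mul, sum_eq_add_sum_ne i₀, extendZero_self]
  congr 1
  · rw [mul_assoc, ← Real.exp_add]
    simp
  · refine Finset.sum_congr rfl fun j _ => ?_
    rw [mul_assoc, ← Real.exp_add, extendZero_coe]
    simp

/-- `e^u`, with value 1 at `i₀`, solves the Schrödinger equation off `i₀`. This linear system is
what recovers `u` from the potential. -/
theorem mulVec_exp (u : {i : V // i ≠ i₀} → ℝ) :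
    (Matrix.diagonal (fieldPotential G W i₀ u) - weightMatrix G W i₀).mulVec
      (fun i => Real.exp (u i)) = fun i : {i : V // i ≠ i₀} => pairWeight G W i i₀ := by
  funext i
  rw [diagonal_sub_mulVec, fieldPotential_mul_exp, add_sub_cancel_right]

-- Equal potentials give the same invertible system for `e^u`.
variable {G W} in
theorem fieldPotential_injective (hG : G.Connected) (hW : ∀ e ∈ G.edgeSet, 0 < W e) :
    Function.Injective (fieldPotential G W i₀) := by
  intro u u' h
  have hu := diagonal_fieldPotential_sub_posDef i₀ hG hW u
  have h1 := mulVec_exp G W i₀ u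
  rw [← mulVec_exp G W i₀ u', ← h] at h1
  have h2 := Matrix.mulVec_injective_of_isUnit hu.isUnit h1
  funext i
  exact Real.exp_injective (congrFun h2 i)

-- For a positive definite operator, solve the system of `mulVec_exp` for `ψ`. The solution is
-- nonnegative because the off-diagonal entries are nonpositive, strictly positive because the graph
-- is connected, and `u = log ψ` is the preimage.
variable {G W} in
theorem range_fieldPotential (hG : G.Connected) (hW : ∀ e ∈ G.edgeSet, 0 < W e) :
    Set.range (fieldPotential G W i₀) =
      {a | (Matrix.diagonal a - weightMatrix G W i₀).PosDef} := by
  refine Set.Subset.antisymm ?_ fun a ha => ?_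
  · rintro _ ⟨u, rfl⟩
    exact diagonal_fieldPotential_sub_posDef i₀ hG hW u
  · have hH : (Matrix.diagonal a - weightMatrix G W i₀).PosDef := ha
    obtain ⟨ψ, hψ⟩ := Matrix.mulVec_surjective_iff_isUnit.2 hH.isUnit fun i => pairWeight G W i i₀
    have hψi : ∀ i, a i * ψ i = pairWeight G W i i₀ +
        ∑ j : {j : V // j ≠ i₀}, pairWeight G W i j * ψ j := fun i => by
      have := congrFun hψ i
      rw [diagonal_sub_mulVec] at this
      linarith
    have hψ0 : ∀ i, 0 ≤ ψ i := nonneg_of_mulVec_nonneg hH (fun i j hij => by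
      simp [Matrix.diagonal_apply_ne _ hij, weightMatrix, pairWeight_nonneg hW]) (fun i => by
        rw [hψ]
        exact pairWeight_nonneg hW _ _)
    set φ : V → ℝ := fun k => if h : k = i₀ then 1 else ψ ⟨k, h⟩ with hφ
    have hφi : ∀ i : {i : V // i ≠ i₀}, φ i = ψ i := fun i => by simp [hφ, i.2]
    have hφ0 : φ i₀ = 1 := by simp [hφ]
    have hφnn : ∀ k, 0 ≤ φ k := fun k => by
      by_cases h : k = i₀
      · rw [h, hφ0]; exact zero_le_one
      · exact (hφi ⟨k, h⟩).symm ▸ hψ0 _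
    have hφs : ∀ i : {i : V // i ≠ i₀}, a i * ψ i = ∑ k, pairWeight G W i k * φ k := fun i => by
      rw [hψi, sum_eq_add_sum_ne i₀, hφ0, mul_one]
      simp only [hφi]
    -- At a zero of `φ` other than `i₀` the equation makes a sum of nonnegative terms vanish, so `φ`
    -- is zero at all neighbours. Along a walk to `i₀` this contradicts `φ i₀ = 1`.
    have hprop : ∀ k l, G.Adj k l → φ k = 0 → φ l = 0 := by
      intro k l hkl hk
      by_cases h : k = i₀
      · rw [h, hφ0] at hk
        exact absurd hk one_ne_zero
      · have h1 := hφs ⟨k, h⟩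
        rw [← hφi ⟨k, h⟩] at h1
        simp only at h1
        rw [hk, mul_zero] at h1
        have h2 := (Finset.sum_eq_zero_iff_of_nonneg fun m _ =>
          mul_nonneg (pairWeight_nonneg hW k m) (hφnn m)).1 h1.symm l (Finset.mem_univ _)
        refine (mul_eq_zero.1 h2).resolve_left ?_
        rw [pairWeight, if_pos hkl]
        exact (hW _ hkl).ne'
    have hwalk : ∀ k l, G.Walk k l → φ k = 0 → φ l = 0 := fun k l p => by
      clear * - p hprop
      induction p with
      | nil => exact id
      | cons h _ ih => exact fun h0 => ih (hprop _ _ h h0)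
    have hψpos : ∀ i, 0 < ψ i := fun i => by
      refine lt_of_le_of_ne (hψ0 i) fun h0 => ?_
      obtain ⟨p⟩ := hG.preconnected i i₀
      have := hwalk _ _ p ((hφi i).trans h0.symm)
      rw [hφ0] at this
      exact one_ne_zero this
    refine ⟨fun i => Real.log (ψ i), funext fun i => ?_⟩
    refine mul_right_cancel₀ (hψpos i).ne' ?_
    have h := fieldPotential_mul_exp G W i₀ (fun i => Real.log (ψ i)) i
    simp only [Real.exp_log (hψpos _)] at h
    rw [h, hψi]

/-- The Jacobian matrix of `fieldPotential`. -/
noncomputable def fieldJacobian (u : {i : V // i ≠ i₀} → ℝ) :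
    Matrix {i : V // i ≠ i₀} {i : V // i ≠ i₀} ℝ :=
  -(Matrix.diagonal (fun i => Real.exp (-u i)) *
    (Matrix.diagonal (fieldPotential G W i₀ u) - weightMatrix G W i₀) *
    Matrix.diagonal (fun i => Real.exp (u i)))

theorem abs_det_fieldJacobian (u : {i : V // i ≠ i₀} → ℝ) :
    |(fieldJacobian G W i₀ u).det| =
      |(Matrix.diagonal (fieldPotential G W i₀ u) - weightMatrix G W i₀).det| := by
  have h : Real.exp (∑ i, -u i) * Real.exp (∑ i, u i) = 1 := by
    rw [← Real.exp_add, ← Finset.sum_add_distrib]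
    simp
  rw [fieldJacobian, Matrix.det_neg, Matrix.det_mul, Matrix.det_mul, Matrix.det_diagonal,
    Matrix.det_diagonal, ← Real.exp_sum, ← Real.exp_sum, abs_mul, abs_pow, abs_neg, abs_one,
    one_pow, one_mul, mul_right_comm, h, one_mul]

/-- The coordinate `k` of the extension by zero, as a continuous linear map. -/
noncomputable def extendZeroCoord (k : V) : ({i : V // i ≠ i₀} → ℝ) →L[ℝ] ℝ :=
  if h : k = i₀ then 0 else ContinuousLinearMap.proj (⟨k, h⟩ : {i : V // i ≠ i₀})

omit [Fintype V] in
theorem extendZeroCoord_apply (k : V) (u : {i : V // i ≠ i₀} → ℝ) :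
    extendZeroCoord i₀ k u = (extendZero i₀ u : V → ℝ) k := by
  by_cases h : k = i₀ <;> simp [extendZeroCoord, extendZero, h]

/-- With `a` the potential, `∂a_i/∂u_j = W_ij e^{u_j - u_i}` for `j ≠ i` and `∂a_i/∂u_i = -a_i`:
minus the Schrödinger operator conjugated by `e^u`. -/
theorem hasFDerivAt_fieldPotential (u : {i : V // i ≠ i₀} → ℝ) :
    HasFDerivAt (fieldPotential G W i₀)
      (Matrix.toLin' (fieldJacobian G W i₀ u)).toContinuousLinearMap u := by
  rw [hasFDerivAt_pi']
  intro i
  have h1 : ∀ k, HasFDerivAt (fun u : {i : V // i ≠ i₀} → ℝ =>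
      pairWeight G W i k * Real.exp ((extendZero i₀ u : V → ℝ) k - u i))
      (pairWeight G W i k • (Real.exp ((extendZero i₀ u : V → ℝ) k - u i) •
        (extendZeroCoord i₀ k - ContinuousLinearMap.proj i))) u := by
    intro k
    have h2 := (extendZeroCoord i₀ k).hasFDerivAt (x := u)
    have h3 := (ContinuousLinearMap.proj (R := ℝ) (φ := fun _ : {i : V // i ≠ i₀} => ℝ)
      i).hasFDerivAt (x := u)
    have h4 := ((h2.sub h3).exp).const_mul (pairWeight G W i k)
    refine (h4.congr_fderiv ?_).congr_of_eventuallyEq (Filter.Eventually.of_forall fun x => ?_)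
    · simp only [Pi.sub_apply, extendZeroCoord_apply, ContinuousLinearMap.proj_apply]
    · simp only [Pi.sub_apply, extendZeroCoord_apply, ContinuousLinearMap.proj_apply]
  have h5 := HasFDerivAt.fun_sum (u := Finset.univ) fun k _ => h1 k
  refine h5.congr_fderiv ?_
  ext v
  simp only [sum_apply, smul_apply,
    sub_apply, extendZeroCoord_apply, ContinuousLinearMap.proj_apply,
    ContinuousLinearMap.comp_apply, LinearMap.coe_toContinuousLinearMap', Matrix.toLin'_apply,
    smul_eq_mul]
  have h6 : ∀ k, pairWeight G W i k * (Real.exp ((extendZero i₀ u : V → ℝ) k - u i) *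
      ((extendZero i₀ v : V → ℝ) k - v i)) =
      pairWeight G W i k * Real.exp ((extendZero i₀ u : V → ℝ) k - u i) *
        (extendZero i₀ v : V → ℝ) k -
      pairWeight G W i k * Real.exp ((extendZero i₀ u : V → ℝ) k - u i) * v i := fun k => by ring
  simp_rw [h6]
  rw [Finset.sum_sub_distrib, ← Finset.sum_mul, sum_eq_add_sum_ne i₀, extendZero_self i₀ v,
    mul_zero, zero_add]
  rw [fieldJacobian, Matrix.neg_mulVec, Pi.neg_apply, ← Matrix.mulVec_mulVec,
    ← Matrix.mulVec_mulVec, Matrix.mulVec_diagonal, diagonal_sub_mulVec]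
  simp only [Matrix.mulVec_diagonal, extendZero_coe]
  have h7 : ∑ j : {j : V // j ≠ i₀}, pairWeight G W i j * Real.exp (u j - u i) * v j =
      Real.exp (-u i) * ∑ j : {j : V // j ≠ i₀}, pairWeight G W i j * (Real.exp (u j) * v j) := by
    rw [Finset.mul_sum]
    refine Finset.sum_congr rfl fun j _ => ?_
    rw [sub_eq_add_neg, Real.exp_add]
    ring
  have h8 : Real.exp (-u i) * Real.exp (u i) = 1 := by rw [← Real.exp_add]; simp
  rw [h7]
  have h9 : ∑ k, pairWeight G W i k * Real.exp ((extendZero i₀ u : V → ℝ) k - u i) =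
      fieldPotential G W i₀ u i := rfl
  rw [h9]
  linear_combination fieldPotential G W i₀ u i * v i * h8

/-- The Jacobian `det H` meets the factor `1/√(det H)` of the density and leaves `√(det H)`. -/
theorem lintegral_schroedingerDensity_fieldPotential (hG : G.Connected)
    (hW : ∀ e ∈ G.edgeSet, 0 < W e) (η : {i : V // i ≠ i₀} → ℝ) :
    ∫⁻ a, schroedingerDensity (weightMatrix G W i₀) η a =
      ∫⁻ u, ENNReal.ofReal
        (schroedingerWeight (Matrix.diagonal (fieldPotential G W i₀ u) - weightMatrix G W i₀) η *
          √(Matrix.diagonal (fieldPotential G W i₀ u) - weightMatrix G W i₀).det) := by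
  have h := lintegral_image_eq_lintegral_abs_det_fderiv_mul
    (volume : Measure ({i : V // i ≠ i₀} → ℝ)) MeasurableSet.univ
    (fun u _ => (hasFDerivAt_fieldPotential G W i₀ u).hasFDerivWithinAt)
    (fieldPotential_injective i₀ hG hW).injOn (schroedingerDensity (weightMatrix G W i₀) η)
  rw [Set.image_univ, range_fieldPotential i₀ hG hW, Measure.restrict_univ,
    ← lintegral_indicator (measurableSet_setOf_diagonal_sub_posDef _)] at h
  have hind : {a | (Matrix.diagonal a - weightMatrix G W i₀).PosDef}.indicator
      (schroedingerDensity (weightMatrix G W i₀) η) =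
      schroedingerDensity (weightMatrix G W i₀) η := by
    funext a
    by_cases ha : (Matrix.diagonal a - weightMatrix G W i₀).PosDef
    · rw [Set.indicator_of_mem (by exact ha)]
    · rw [Set.indicator_of_notMem (by exact ha), schroedingerDensity, if_neg ha]
  rw [hind] at h
  rw [h]
  refine lintegral_congr fun u => ?_
  have hp := diagonal_fieldPotential_sub_posDef i₀ hG hW u
  set H := Matrix.diagonal (fieldPotential G W i₀ u) - weightMatrix G W i₀ with hH
  have hdet : ((Matrix.toLin' (fieldJacobian G W i₀ u)).toContinuousLinearMap).det =
      (fieldJacobian G W i₀ u).det := by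
    rw [ContinuousLinearMap.det, LinearMap.coe_toContinuousLinearMap, LinearMap.det_toLin']
  rw [hdet, abs_det_fieldJacobian, ← hH, schroedingerDensity, if_pos (by exact hp), ← hH,
    abs_of_pos hp.det_pos, ← ENNReal.ofReal_mul hp.det_pos.le]
  congr 1
  have hs : √H.det * √H.det = H.det := Real.mul_self_sqrt hp.det_pos.le
  have hs0 : √H.det ≠ 0 := (Real.sqrt_pos.2 hp.det_pos).ne'
  field_simp
  nth_rw 1 [← hs]
  ring

/-- For `η_i = W_{i i₀}` one has `H⁻¹ η = e^u`, so every term of the exponent is linear in the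
exponentials `e^{u_k - u_l}`; they combine to the hyperbolic cosines of the action. -/
theorem schroedingerWeight_fieldPotential (hG : G.Connected)
    (hW : ∀ e ∈ G.edgeSet, 0 < W e) (u : {i : V // i ≠ i₀} → ℝ) :
    schroedingerWeight (Matrix.diagonal (fieldPotential G W i₀ u) - weightMatrix G W i₀)
      (fun i => pairWeight G W i i₀) = boltzmann G W 0 (extendZero i₀ u : V → ℝ) := by
  have hp := diagonal_fieldPotential_sub_posDef i₀ hG hW u
  have h0 := mulVec_exp G W i₀ u
  have h1 : ∀ i, (Matrix.diagonal (fieldPotential G W i₀ u) - weightMatrix G W i₀).mulVec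
      (fun _ => 1) i = fieldPotential G W i₀ u i - ∑ j : {j : V // j ≠ i₀}, pairWeight G W i j := by
    intro i
    rw [diagonal_sub_mulVec]
    simp only [mul_one]
  set H := Matrix.diagonal (fieldPotential G W i₀ u) - weightMatrix G W i₀ with hH
  have hHu : IsUnit H.det := (Matrix.isUnit_iff_isUnit_det _).1 hp.isUnit
  have hinv : H⁻¹.mulVec (fun i => pairWeight G W i i₀) = fun i => Real.exp (u i) := by
    rw [← h0, Matrix.mulVec_mulVec, Matrix.nonsing_inv_mul _ hHu, Matrix.one_mulVec]
  rw [schroedingerWeight, hinv, boltzmann]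
  congr 1
  set û : V → ℝ := (extendZero i₀ u : V → ℝ) with hû
  have h2 := sum_edges_eq G (fun e => W e * edgeAction 0 û e)
  -- Over ordered pairs each edge appears in both directions, so `cosh (u_k - u_l)` may be replaced
  -- by the single exponential `e^{u_l - u_k}`.
  have h3 : ∑ k, ∑ l, (if G.Adj k l then W s(k, l) * edgeAction 0 û s(k, l) else 0) =
      ∑ k, ∑ l, pairWeight G W k l * (1 - Real.exp (û l - û k)) := by
    have e1 : ∀ k l, (if G.Adj k l then W s(k, l) * edgeAction 0 û s(k, l) else 0) =
        1 / 2 * (pairWeight G W k l * (1 - Real.exp (û l - û k))) +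
        1 / 2 * (pairWeight G W l k * (1 - Real.exp (û k - û l))) := by
      intro k l
      rw [pairWeight_comm G W l k, pairWeight]
      split_ifs
      · simp only [edgeAction, Sym2.lift_mk, Pi.zero_apply, Real.cosh_eq, neg_sub]
        ring
      · ring
    simp_rw [e1, Finset.sum_add_distrib, ← Finset.mul_sum]
    rw [Finset.sum_comm (f := fun k l => pairWeight G W l k * (1 - Real.exp (û k - û l)))]
    ring
  rw [h3, sum_eq_add_sum_ne i₀, sum_eq_add_sum_ne i₀] at h2
  have hû0 : û i₀ = 0 := extendZero_self i₀ u
  have hûi : ∀ i : {i : V // i ≠ i₀}, û i = u i := extendZero_coe i₀ u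
  simp only [hû0, hûi, sub_self, Real.exp_zero, mul_zero, zero_add, sub_zero] at h2
  have h4 : ∀ i : {i : V // i ≠ i₀}, ∑ l, pairWeight G W i l * (1 - Real.exp (û l - u i)) =
      pairWeight G W i i₀ + (∑ j : {j : V // j ≠ i₀}, pairWeight G W i j) -
        fieldPotential G W i₀ u i := by
    intro i
    simp only [mul_sub, mul_one, Finset.sum_sub_distrib]
    rw [sum_eq_add_sum_ne i₀ (fun l => pairWeight G W i l)]
    rfl
  simp_rw [h4] at h2
  simp only [dotProduct, h1, one_mul]
  simp only [mul_sub, mul_one, Finset.sum_sub_distrib, Finset.sum_add_distrib,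
    pairWeight_comm G W i₀] at h2 ⊢
  linarith

/-- The integral of the marginal in `u` of the `H^{2|2}` model, up to a constant. -/
theorem lintegral_boltzmann_mul_sqrt_det (hG : G.Connected) (hW : ∀ e ∈ G.edgeSet, 0 < W e) :
    ∫⁻ u : {i : V // i ≠ i₀} → ℝ, ENNReal.ofReal (boltzmann G W 0 (extendZero i₀ u : V → ℝ) *
      √(reducedLaplacian G
        (fun e => W e * Real.exp (edgeSum (extendZero i₀ u : V → ℝ) e)) i₀).det *
      Real.exp (-∑ i, u i)) =
    ENNReal.ofReal (√(2 * Real.pi) ^ Fintype.card {i : V // i ≠ i₀}) := by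
  have hsymm : (weightMatrix G W i₀).IsSymm := by
    ext i j
    exact pairWeight_comm G W _ _
  rw [← lintegral_schroedingerDensity hsymm (fun i j => pairWeight_nonneg hW i j)
    (fun i => pairWeight_nonneg hW i i₀), lintegral_schroedingerDensity_fieldPotential G W i₀ hG hW]
  refine lintegral_congr fun u => ?_
  rw [schroedingerWeight_fieldPotential G W i₀ hG hW, det_diagonal_sub_mul,
    Real.sqrt_mul (diagonal_fieldPotential_sub_posDef i₀ hG hW u).det_pos.le,
    Real.sqrt_sq (Real.exp_pos _).le, mul_assoc, mul_assoc, ← Real.exp_add, add_neg_cancel,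
    Real.exp_zero, mul_one]

end FieldCoordinates

/-! ### Currents, gradient flows and the Gaussian integral over `ℋ` -/

section CurrentIntegral

variable {V : Type*} [Fintype V] [DecidableEq V] {G : SimpleGraph V} [DecidableRel G.Adj]

/-- The inverse of the restriction of currents to the complement of a spanning tree. -/
noncomputable def restrictSymm (T₀ : DirectedSpanningTree G) :
    ({d : G.Dart // d ∉ T₀.darts} → ℝ) ≃ₗ[ℝ] Currents G :=
  (LinearEquiv.ofBijective (restrict T₀) (restrict_bijective T₀)).symm

theorem restrictSymm_apply (T₀ : DirectedSpanningTree G) (x : {d : G.Dart // d ∉ T₀.darts} → ℝ)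
    (d : {d : G.Dart // d ∉ T₀.darts}) : (restrictSymm T₀ x : G.Dart → ℝ) d = x d :=
  congrFun ((LinearEquiv.ofBijective (restrict T₀) (restrict_bijective T₀)).apply_symm_apply x) d

theorem continuous_restrictSymm (T₀ : DirectedSpanningTree G) : Continuous (restrictSymm T₀) :=
  LinearMap.continuous_of_finiteDimensional (restrictSymm T₀).toLinearMap

theorem lintegral_currentVolume (T₀ : DirectedSpanningTree G) {f : Currents G → ℝ≥0∞}
    (hf : Measurable f) :
    ∫⁻ κ, f κ ∂(currentVolume T₀) = ∫⁻ x, f (restrictSymm T₀ x) :=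
  lintegral_map hf (continuous_restrictSymm T₀).measurable

theorem netOutflow_apply (κ : G.Dart → ℝ) (i : V) :
    netOutflow G κ i = ∑ d : G.Dart, κ d * incidence ℝ (d.fst, d.snd) i := by
  have h1 : netOutflow G κ i = ∑ d : G.Dart, if d.fst = i then κ d - κ d.symm else 0 :=
    Finset.sum_filter _ _
  have h2 : ∑ d : G.Dart, (if d.fst = i then κ d.symm else 0) =
      ∑ d : G.Dart, if d.snd = i then κ d else 0 := by
    refine Fintype.sum_bijective SimpleGraph.Dart.symm
      SimpleGraph.Dart.symm_involutive.bijective _ _ fun d => ?_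
    simp
  have h3 : ∀ d : G.Dart, (if d.fst = i then κ d - κ d.symm else 0) =
      (if d.fst = i then κ d else 0) - if d.fst = i then κ d.symm else 0 := fun d => by
    split_ifs <;> simp
  rw [h1, Finset.sum_congr rfl fun d _ => h3 d, Finset.sum_sub_distrib, h2,
    ← Finset.sum_sub_distrib]
  refine Finset.sum_congr rfl fun d _ => ?_
  simp only [incidence, mul_sub, mul_ite, mul_one, mul_zero]

theorem sum_mul_netOutflow (κ : G.Dart → ℝ) (φ : V → ℝ) :
    ∑ i, φ i * netOutflow G κ i = ∑ d : G.Dart, κ d * (φ d.fst - φ d.snd) := by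
  simp only [netOutflow_apply, Finset.mul_sum]
  rw [Finset.sum_comm]
  refine Finset.sum_congr rfl fun d _ => ?_
  rw [← sum_incidence_mul (d.fst, d.snd) φ, Finset.mul_sum]
  exact Finset.sum_congr rfl fun i _ => by ring

variable (G) in
/-- The gradient flow `ω_ij (φ_i - φ_j)` of a potential that vanishes at `i₀`. -/
noncomputable def gradientFlow (ω : Sym2 V → ℝ) (i₀ : V) :
    ({i : V // i ≠ i₀} → ℝ) →ₗ[ℝ] (G.Dart → ℝ) :=
  LinearMap.pi fun d => ω d.edge •
    (extendZeroCoord i₀ d.fst - extendZeroCoord i₀ d.snd : ({i : V // i ≠ i₀} → ℝ) →L[ℝ] ℝ)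

omit [Fintype V] [DecidableRel G.Adj] in
theorem gradientFlow_apply (ω : Sym2 V → ℝ) (i₀ : V) (φ : {i : V // i ≠ i₀} → ℝ) (d : G.Dart) :
    gradientFlow G ω i₀ φ d =
      ω d.edge * ((extendZero i₀ φ : V → ℝ) d.fst - (extendZero i₀ φ : V → ℝ) d.snd) := by
  simp [gradientFlow, extendZeroCoord_apply]

/-- The flow is antisymmetric under reversal of a directed edge, so both orientations contribute
equally; this is the origin of the factor 2. -/
theorem netOutflow_gradientFlow (ω : Sym2 V → ℝ) (i₀ : V) (φ : {i : V // i ≠ i₀} → ℝ)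
    (i : {i : V // i ≠ i₀}) :
    netOutflow G (gradientFlow G ω i₀ φ) i = (2 • reducedLaplacian G ω i₀).mulVec φ i := by
  have h1 : φ = fun j : {j : V // j ≠ i₀} => (extendZero i₀ φ : V → ℝ) j := by
    funext j
    rw [extendZero_coe]
  have h3 : netOutflow G (gradientFlow G ω i₀ φ) i =
      ∑ d : G.Dart, if d.fst = i then gradientFlow G ω i₀ φ d - gradientFlow G ω i₀ φ d.symm
        else 0 :=
    Finset.sum_filter _ _
  rw [Matrix.smul_mulVec, Pi.smul_apply]
  nth_rw 2 [h1]
  rw [reducedLaplacian_mulVec G ω i₀ _ (extendZero_self i₀ φ), h3]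
  have h4 : ∀ d : G.Dart, (if d.fst = i then
      gradientFlow G ω i₀ φ d - gradientFlow G ω i₀ φ d.symm else 0) =
      (fun k l => if k = (i : V) then 2 * (ω s(k, l) *
        ((extendZero i₀ φ : V → ℝ) k - (extendZero i₀ φ : V → ℝ) l)) else 0) d.fst d.snd := by
    intro d
    simp only [gradientFlow_apply, SimpleGraph.Dart.edge_symm]
    split_ifs
    · have : d.edge = s(d.fst, d.snd) := rfl
      rw [this]
      simp only [SimpleGraph.Dart.symm_toProd, Prod.fst_swap, Prod.snd_swap]
      ring
    · rfl
  rw [Finset.sum_congr rfl fun d _ => h4 d, sum_darts_eq G (fun k l => if k = (i : V) then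
    2 * (ω s(k, l) * ((extendZero i₀ φ : V → ℝ) k - (extendZero i₀ φ : V → ℝ) l)) else 0),
    Finset.sum_eq_single (i : V) (fun k _ hk => by simp [hk]) (by simp), nsmul_eq_mul,
    Finset.mul_sum]
  refine Finset.sum_congr rfl fun l _ => ?_
  simp

/-- The restriction of a flow to the directed edges outside a spanning tree. -/
def offTree (T₀ : DirectedSpanningTree G) :
    (G.Dart → ℝ) →ₗ[ℝ] ({d : G.Dart // d ∉ T₀.darts} → ℝ) :=
  LinearMap.funLeft ℝ ℝ Subtype.val

/-- The part of a flow that remains after subtracting the current with the same values outside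
the spanning tree. -/
noncomputable def treePart (T₀ : DirectedSpanningTree G) :
    (G.Dart → ℝ) →ₗ[ℝ] (G.Dart → ℝ) :=
  LinearMap.id - (Currents G).subtype ∘ₗ (restrictSymm T₀ : _ →ₗ[ℝ] _) ∘ₗ offTree T₀

theorem treePart_apply (T₀ : DirectedSpanningTree G) (κ : G.Dart → ℝ) :
    treePart T₀ κ = κ - (restrictSymm T₀ (offTree T₀ κ) : G.Dart → ℝ) := rfl

theorem treePart_apply_of_notMem (T₀ : DirectedSpanningTree G) (κ : G.Dart → ℝ) {d : G.Dart}
    (hd : d ∉ T₀.darts) : treePart T₀ κ d = 0 := by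
  rw [treePart_apply, Pi.sub_apply, restrictSymm_apply T₀ _ ⟨d, hd⟩]
  exact sub_self _

theorem netOutflow_treePart (T₀ : DirectedSpanningTree G) (κ : G.Dart → ℝ) :
    netOutflow G (treePart T₀ κ) = netOutflow G κ := by
  have : netOutflow G (restrictSymm T₀ (offTree T₀ κ) : G.Dart → ℝ) = 0 :=
    (restrictSymm T₀ (offTree T₀ κ)).2
  rw [treePart_apply, map_sub, this, sub_zero]

/-- Change of variables on the flows supported in a spanning tree, from flows to potentials. -/
theorem lintegral_tree_eq (T₀ : DirectedSpanningTree G) (ω : Sym2 V → ℝ) (i₀ : V)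
    (hL : (2 • reducedLaplacian G ω i₀).det ≠ 0)
    {f : ({d : G.Dart // ¬ d ∉ T₀.darts} → ℝ) → ℝ≥0∞} (hf : Measurable f) :
    ∫⁻ z, f z = ENNReal.ofReal |(2 • reducedLaplacian G ω i₀).det| *
      ∫⁻ φ : {i : V // i ≠ i₀} → ℝ, f (fun d => treePart T₀ (gradientFlow G ω i₀ φ) d) := by
  have hcard : T₀.darts.card = Fintype.card {i : V // i ≠ i₀} := by
    rw [← Finset.card_image_of_injOn T₀.injOn]
    exact T₀.isSpanningTree.card_eq i₀
  obtain ⟨e⟩ : Nonempty ({i : V // i ≠ i₀} ≃ {d : G.Dart // ¬ d ∉ T₀.darts}) :=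
    Fintype.card_eq.1 (by simp only [not_not]; rw [← hcard, Fintype.card_coe])
  have hmem : ∀ i, (e i : G.Dart) ∈ T₀.darts := fun i => not_not.1 (e i).2
  set M : Matrix {i : V // i ≠ i₀} {i : V // i ≠ i₀} ℝ :=
    Matrix.of fun i j => incidence ℝ ((e i : G.Dart).fst, (e i : G.Dart).snd) j with hM
  have hrange : (Set.range fun i => s((e i : G.Dart).fst, (e i : G.Dart).snd)) =
      ((T₀.darts.image SimpleGraph.Dart.edge : Finset (Sym2 V)) : Set (Sym2 V)) := by
    ext x
    simp only [Set.mem_range, Finset.coe_image, Set.mem_image, Finset.mem_coe]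
    refine ⟨fun ⟨i, hi⟩ => ⟨e i, hmem i, hi⟩, fun ⟨d, hd, hx⟩ =>
      ⟨e.symm ⟨d, not_not.2 hd⟩, by rw [Equiv.apply_symm_apply]; exact hx⟩⟩
  -- `M` is the incidence matrix of the reference tree without the column of `i₀`; its unimodularity
  -- makes the Jacobian independent of the tree.
  have hMdet : M.det ^ 2 = 1 := by
    refine det_incidence_sq_of_isTree
      (fun i => ((e i : G.Dart).fst, (e i : G.Dart).snd)) ?_ ?_ ?_
    · intro i j h
      exact e.injective (Subtype.ext (T₀.injOn (hmem i) (hmem j) h))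
    · rw [hrange]
      exact T₀.isSpanningTree.2
    · intro i
      exact (e i : G.Dart).adj.ne
  set C : ({i : V // i ≠ i₀} → ℝ) →ₗ[ℝ] ({i : V // i ≠ i₀} → ℝ) :=
    LinearMap.funLeft ℝ ℝ (fun i => (e i : G.Dart)) ∘ₗ treePart T₀ ∘ₗ gradientFlow G ω i₀ with hC
  have hCφ : ∀ φ i, C φ i = treePart T₀ (gradientFlow G ω i₀ φ) (e i) := fun φ i => rfl
  -- The tree part differs from the gradient flow by a current, hence has the same net outflow, and
  -- it is supported on the tree. Computing this outflow with the incidence matrix factors `2L` as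
  -- `Mᵀ C`.
  have hMC : M.transpose * LinearMap.toMatrix' C = 2 • reducedLaplacian G ω i₀ := by
    refine Matrix.mulVec_injective ?_
    funext φ
    rw [← Matrix.mulVec_mulVec, LinearMap.toMatrix'_mulVec]
    funext i
    rw [← netOutflow_gradientFlow, ← netOutflow_treePart T₀, netOutflow_apply, Matrix.mulVec,
      dotProduct]
    rw [← Fintype.sum_subtype_add_sum_subtype (fun d : G.Dart => d ∉ T₀.darts),
      Finset.sum_eq_zero (s := Finset.univ) (f := fun d : {d : G.Dart // d ∉ T₀.darts} => _),
      zero_add, ← Equiv.sum_comp e]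
    · refine Finset.sum_congr rfl fun j _ => ?_
      rw [Matrix.transpose_apply, hM, Matrix.of_apply, hCφ, mul_comm]
    · intro d _
      rw [treePart_apply_of_notMem T₀ _ d.2, zero_mul]
  have hdet : |(LinearMap.toMatrix' C).det| = |(2 • reducedLaplacian G ω i₀).det| := by
    have h1 : |M.det| = 1 :=
      (pow_eq_one_iff_of_nonneg (abs_nonneg _) two_ne_zero).1 (by rw [sq_abs, hMdet])
    rw [← hMC, Matrix.det_mul, Matrix.det_transpose, abs_mul, h1, one_mul]
  have hC0 : (LinearMap.toMatrix' C).det ≠ 0 := by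
    rw [← abs_ne_zero, hdet, abs_ne_zero]
    exact hL
  have h1 := (volume_measurePreserving_piCongrLeft
    (fun _ : {d : G.Dart // ¬ d ∉ T₀.darts} => ℝ) e).lintegral_comp hf
  rw [← h1, lintegral_comp_mulVec _ hC0, hdet]
  congr 1
  refine lintegral_congr fun φ => ?_
  congr 1
  funext d
  obtain ⟨i, rfl⟩ := e.surjective d
  rw [MeasurableEquiv.coe_piCongrLeft, Equiv.piCongrLeft_apply_apply, LinearMap.toMatrix'_mulVec,
    hCφ]

theorem measurable_comp_add_gradientFlow (T₀ : DirectedSpanningTree G) (ω : Sym2 V → ℝ) (i₀ : V)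
    {g : (G.Dart → ℝ) → ℝ≥0∞} (hg : Measurable g) :
    Measurable fun p : ({d : G.Dart // d ∉ T₀.darts} → ℝ) × ({i : V // i ≠ i₀} → ℝ) =>
      g ((restrictSymm T₀ p.1 : G.Dart → ℝ) + gradientFlow G ω i₀ p.2) := by
  refine hg.comp (Continuous.measurable ?_)
  exact (continuous_subtype_val.comp ((continuous_restrictSymm T₀).comp continuous_fst)).add
    ((LinearMap.continuous_of_finiteDimensional (gradientFlow G ω i₀)).comp continuous_snd)

/-- Decomposition of the Lebesgue measure on flows into currents and gradient flows. -/
theorem lintegral_flow_eq (T₀ : DirectedSpanningTree G) (ω : Sym2 V → ℝ) (i₀ : V)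
    (hL : (2 • reducedLaplacian G ω i₀).det ≠ 0) {g : (G.Dart → ℝ) → ℝ≥0∞} (hg : Measurable g) :
    ∫⁻ κ, g κ = ENNReal.ofReal |(2 • reducedLaplacian G ω i₀).det| *
      ∫⁻ φ : {i : V // i ≠ i₀} → ℝ, ∫⁻ x,
        g ((restrictSymm T₀ x : G.Dart → ℝ) + gradientFlow G ω i₀ φ) := by
  have h1 := (volume_preserving_piEquivPiSubtypeProd (fun _ : G.Dart => ℝ)
    (fun d => d ∉ T₀.darts)).symm.lintegral_comp hg
  rw [← h1, Measure.volume_eq_prod, lintegral_prod _ (by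
    exact (hg.comp (MeasurableEquiv.measurable _)).aemeasurable)]
  -- For fixed off-tree values `x`, translate the tree values by those of the current extending `x`;
  -- the rest is parametrised by potentials. The sum is again a current plus a gradient flow, with
  -- the off-tree part of the gradient flow subtracted from `x`.
  have h2 : ∀ x : {d : G.Dart // d ∉ T₀.darts} → ℝ,
      ∫⁻ z, g ((MeasurableEquiv.piEquivPiSubtypeProd (fun _ : G.Dart => ℝ)
        (fun d => d ∉ T₀.darts)).symm (x, z)) =
      ENNReal.ofReal |(2 • reducedLaplacian G ω i₀).det| * ∫⁻ φ : {i : V // i ≠ i₀} → ℝ,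
        g ((restrictSymm T₀ (x - offTree T₀ (gradientFlow G ω i₀ φ)) : G.Dart → ℝ) +
          gradientFlow G ω i₀ φ) := by
    intro x
    rw [← lintegral_add_right_eq_self _
      (fun d : {d : G.Dart // ¬ d ∉ T₀.darts} => (restrictSymm T₀ x : G.Dart → ℝ) d),
      lintegral_tree_eq T₀ ω i₀ hL]
    · congr 1
      refine lintegral_congr fun φ => ?_
      congr 1
      funext d
      have hsub : (restrictSymm T₀ (x - offTree T₀ (gradientFlow G ω i₀ φ)) : G.Dart → ℝ) d =
          (restrictSymm T₀ x : G.Dart → ℝ) d -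
          (restrictSymm T₀ (offTree T₀ (gradientFlow G ω i₀ φ)) : G.Dart → ℝ) d := by
        rw [map_sub]
        rfl
      rw [Pi.add_apply, hsub]
      by_cases hd : d ∉ T₀.darts
      · have h3 : offTree T₀ (gradientFlow G ω i₀ φ) ⟨d, hd⟩ = gradientFlow G ω i₀ φ d := rfl
        rw [restrictSymm_apply T₀ _ ⟨d, hd⟩, restrictSymm_apply T₀ _ ⟨d, hd⟩, h3, sub_add_cancel]
        exact dif_pos hd
      · refine (dif_neg hd).trans ?_
        change treePart T₀ (gradientFlow G ω i₀ φ) d + (restrictSymm T₀ x : G.Dart → ℝ) d = _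
        rw [treePart_apply, Pi.sub_apply]
        ring
    · exact hg.comp ((MeasurableEquiv.measurable _).comp
        (measurable_const.prodMk (measurable_id.add_const _)))
  have hm := measurable_comp_add_gradientFlow T₀ ω i₀ hg
  have hm' : Measurable fun p : ({d : G.Dart // d ∉ T₀.darts} → ℝ) × ({i : V // i ≠ i₀} → ℝ) =>
      g ((restrictSymm T₀ (p.1 - offTree T₀ (gradientFlow G ω i₀ p.2)) : G.Dart → ℝ) +
        gradientFlow G ω i₀ p.2) := by
    refine hm.comp (Measurable.prodMk (measurable_fst.sub ?_) measurable_snd)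
    exact ((LinearMap.continuous_of_finiteDimensional
      (offTree T₀ ∘ₗ gradientFlow G ω i₀)).comp continuous_snd).measurable
  rw [lintegral_congr h2, lintegral_const_mul' _ _ ENNReal.ofReal_ne_top,
    lintegral_lintegral_swap hm'.aemeasurable]
  congr 1
  -- With `φ` now the outer variable, translation invariance in `x` removes this subtraction.
  refine lintegral_congr fun φ => ?_
  exact lintegral_sub_right_eq_self (fun x => g ((restrictSymm T₀ x : G.Dart → ℝ) +
    gradientFlow G ω i₀ φ)) _

omit [Fintype V] [DecidableEq V] in
theorem sq_sub_out_edge (y : V → ℝ) (k l : V) :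
    (y (Quot.out s(k, l)).1 - y (Quot.out s(k, l)).2) ^ 2 = (y k - y l) ^ 2 := by
  have h := sym2_mk_out s(k, l)
  rw [Sym2.eq_iff] at h
  rcases h with ⟨h1, h2⟩ | ⟨h1, h2⟩
  · rw [h1, h2]
  · rw [h1, h2]
    ring

/-- The cross term is `∑ κ_d (φ_i - φ_j)`, which by summation by parts pairs `φ` with the net
outflow of `κ` and so vanishes. -/
theorem sum_sq_add_gradientFlow {ω : Sym2 V → ℝ} (hω : ∀ e ∈ G.edgeSet, 0 < ω e) (i₀ : V)
    (κ : Currents G) (φ : {i : V // i ≠ i₀} → ℝ) :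
    ∑ d : G.Dart, ((κ : G.Dart → ℝ) d + gradientFlow G ω i₀ φ d) ^ 2 / (2 * ω d.edge) =
      ∑ d : G.Dart, (κ : G.Dart → ℝ) d ^ 2 / (2 * ω d.edge) +
        φ ⬝ᵥ (2 • reducedLaplacian G ω i₀).mulVec φ / 2 := by
  set y : V → ℝ := (extendZero i₀ φ : V → ℝ) with hy
  have hφ : φ = fun j : {j : V // j ≠ i₀} => y j := by
    funext j
    rw [hy, extendZero_coe]
  have h1 : ∀ d : G.Dart, ((κ : G.Dart → ℝ) d + gradientFlow G ω i₀ φ d) ^ 2 / (2 * ω d.edge) =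
      (κ : G.Dart → ℝ) d ^ 2 / (2 * ω d.edge) + (κ : G.Dart → ℝ) d * (y d.fst - y d.snd) +
        1 / 2 * (ω d.edge * (y (Quot.out d.edge).1 - y (Quot.out d.edge).2) ^ 2) := by
    intro d
    have h := (hω d.edge d.edge_mem).ne'
    have he : d.edge = s(d.fst, d.snd) := rfl
    rw [gradientFlow_apply, ← hy]
    nth_rw 6 [he]
    nth_rw 5 [he]
    rw [sq_sub_out_edge]
    field_simp
    ring
  have h2 : ∑ d : G.Dart, (κ : G.Dart → ℝ) d * (y d.fst - y d.snd) = 0 := by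
    rw [← sum_mul_netOutflow]
    have : netOutflow G (κ : G.Dart → ℝ) = 0 := κ.2
    simp [this]
  have h3 := sum_darts_edge G (fun e => ω e * (y (Quot.out e).1 - y (Quot.out e).2) ^ 2)
  have h4 := reducedLaplacian_quadratic G ω i₀ y (extendZero_self i₀ φ)
  rw [← hφ] at h4
  rw [Finset.sum_congr rfl fun d _ => h1 d, Finset.sum_add_distrib, Finset.sum_add_distrib, h2,
    ← Finset.mul_sum, h3, ← h4, Matrix.smul_mulVec, dotProduct_smul, nsmul_eq_mul]
  push_cast
  ring

/-- Each undirected edge carries two directed ones, so the square roots pair up. -/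
theorem prod_darts_sqrt {ω : Sym2 V → ℝ} (hω : ∀ e ∈ G.edgeSet, 0 < ω e) :
    ∏ d : G.Dart, √(2 * Real.pi * ω d.edge) =
      (2 * Real.pi) ^ G.edgeFinset.card * ∏ e ∈ G.edgeFinset, ω e := by
  rw [← Finset.prod_fiberwise_of_maps_to (s := Finset.univ) (t := G.edgeFinset)
    (g := fun d : G.Dart => d.edge), ← Finset.prod_const, ← Finset.prod_mul_distrib]
  · refine Finset.prod_congr rfl fun e he => ?_
    have he' := SimpleGraph.mem_edgeFinset.1 he
    rw [Finset.prod_congr rfl (g := fun _ => √(2 * Real.pi * ω e)), Finset.prod_const,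
      G.dart_edge_fiber_card e he', Real.sq_sqrt]
    · have := hω e he'
      positivity
    · intro d hd
      rw [(Finset.mem_filter.1 hd).2]
  · intro d _
    exact SimpleGraph.mem_edgeFinset.2 d.edge_mem

omit [DecidableEq V] in
theorem measurable_exp_neg_sum_sq (ω : Sym2 V → ℝ) :
    Measurable fun κ : G.Dart → ℝ =>
      ENNReal.ofReal (Real.exp (-∑ d : G.Dart, κ d ^ 2 / (2 * ω d.edge))) := by
  fun_prop

/-- The Gaussian integral over the sourceless currents. -/
theorem lintegral_exp_currents (hG : G.Connected) (T₀ : DirectedSpanningTree G) {ω : Sym2 V → ℝ}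
    (hω : ∀ e ∈ G.edgeSet, 0 < ω e) (i₀ : V) :
    ∫⁻ κ, ENNReal.ofReal (Real.exp (-∑ d : G.Dart, (κ : G.Dart → ℝ) d ^ 2 / (2 * ω d.edge)))
      ∂(currentVolume T₀) =
    ENNReal.ofReal ((2 * Real.pi) ^ G.edgeFinset.card * (∏ e ∈ G.edgeFinset, ω e) /
      (√(2 * Real.pi) ^ Fintype.card {i : V // i ≠ i₀} *
        √(2 • reducedLaplacian G ω i₀).det)) := by
  have hL : (2 • reducedLaplacian G ω i₀).PosDef := by
    rw [two_smul]
    exact (reducedLaplacian_posDef G hG ω hω i₀).add (reducedLaplacian_posDef G hG ω hω i₀)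
  set L := 2 • reducedLaplacian G ω i₀ with hLdef
  have hd := hL.det_pos
  rw [lintegral_currentVolume T₀ (f := fun κ : Currents G => ENNReal.ofReal (Real.exp
    (-∑ d : G.Dart, (κ : G.Dart → ℝ) d ^ 2 / (2 * ω d.edge))))
    ((measurable_exp_neg_sum_sq ω).comp measurable_subtype_coe)]
  -- The Gaussian mass of all flows factors as `det (2L)` times the Gaussian integral over `φ` times
  -- the wanted integral; dividing gives the claim.
  have h1 := lintegral_flow_eq T₀ ω i₀ hL.det_pos.ne' (measurable_exp_neg_sum_sq ω)
  have h2 : ∫⁻ κ : G.Dart → ℝ, ENNReal.ofReal (Real.exp (-∑ d : G.Dart, κ d ^ 2 /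
      (2 * ω d.edge))) =
      ENNReal.ofReal ((2 * Real.pi) ^ G.edgeFinset.card * ∏ e ∈ G.edgeFinset, ω e) := by
    have h := lintegral_exp_neg_sum_sq (c := fun d : G.Dart => 1 / (2 * ω d.edge))
      (fun d => by have := hω d.edge d.edge_mem; positivity)
    rw [← prod_darts_sqrt hω]
    convert h using 1
    · refine lintegral_congr fun κ => ?_
      simp only [one_div_mul_eq_div]
    · congr 1
      refine Finset.prod_congr rfl fun d _ => ?_
      congr 1
      rw [div_div_eq_mul_div, div_one]
      ring
  have h3 : ∀ φ : {i : V // i ≠ i₀} → ℝ, ∫⁻ x, ENNReal.ofReal (Real.exp (-∑ d : G.Dart,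
      ((restrictSymm T₀ x : G.Dart → ℝ) + gradientFlow G ω i₀ φ) d ^ 2 / (2 * ω d.edge))) =
      ENNReal.ofReal (Real.exp (-(φ ⬝ᵥ L.mulVec φ) / 2)) * ∫⁻ x, ENNReal.ofReal (Real.exp
        (-∑ d : G.Dart, (restrictSymm T₀ x : G.Dart → ℝ) d ^ 2 / (2 * ω d.edge))) := by
    intro φ
    rw [← lintegral_const_mul' _ _ ENNReal.ofReal_ne_top]
    refine lintegral_congr fun x => ?_
    simp only [Pi.add_apply]
    rw [sum_sq_add_gradientFlow hω i₀, ← hLdef, ← ENNReal.ofReal_mul (Real.exp_pos _).le,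
      ← Real.exp_add]
    congr 2
    ring
  set I := ∫⁻ x, ENNReal.ofReal (Real.exp
    (-∑ d : G.Dart, (restrictSymm T₀ x : G.Dart → ℝ) d ^ 2 / (2 * ω d.edge))) with hI
  have hI' : ∫⁻ x, (fun κ : Currents G => ENNReal.ofReal (Real.exp
    (-∑ d : G.Dart, (κ : G.Dart → ℝ) d ^ 2 / (2 * ω d.edge)))) (restrictSymm T₀ x) = I := rfl
  rw [lintegral_congr h3, h2, lintegral_mul_const _ (by
      refine ENNReal.measurable_ofReal.comp (Real.measurable_exp.comp (Continuous.measurable ?_))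
      exact ((Continuous.dotProduct continuous_id (Continuous.matrix_mulVec continuous_const
        continuous_id)).neg).div_const 2), lintegral_exp_neg_quadratic L hL,
    ← mul_assoc, ← ENNReal.ofReal_mul (abs_nonneg _), abs_of_pos hd] at h1
  have hs : √L.det * √L.det = L.det := Real.mul_self_sqrt hd.le
  have hs0 : 0 < √L.det := Real.sqrt_pos.2 hd
  have h4 : L.det * (√(2 * Real.pi) ^ Fintype.card {i : V // i ≠ i₀} / √L.det) =
      √(2 * Real.pi) ^ Fintype.card {i : V // i ≠ i₀} * √L.det := by
    field_simp
    rw [pow_two, hs]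
  have hpos : 0 < √(2 * Real.pi) ^ Fintype.card {i : V // i ≠ i₀} * √L.det := by positivity
  rw [h4] at h1
  rw [ENNReal.ofReal_div_of_pos hpos, h1, mul_comm, ENNReal.mul_div_cancel_right
    (by simpa using hpos) ENNReal.ofReal_ne_top]

end CurrentIntegral

/-! ### Integrating out currents, vertices and one tree -/

section Marginals

theorem map_snd_withDensity_prod {α β : Type*} [MeasurableSpace α] [MeasurableSpace β]
    (μ : Measure α) (ν : Measure β) [SFinite μ] [SFinite ν] {f : α × β → ℝ≥0∞}
    (hf : Measurable f) :
    ((μ.prod ν).withDensity f).map Prod.snd = ν.withDensity fun b => ∫⁻ a, f (a, b) ∂μ := by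
  refine Measure.ext_of_lintegral _ fun g hg => ?_
  rw [lintegral_map hg measurable_snd, lintegral_withDensity_eq_lintegral_mul _ hf
    (show Measurable fun p : α × β => g p.2 from hg.comp measurable_snd),
    lintegral_withDensity_eq_lintegral_mul _ hf.lintegral_prod_left' hg,
    lintegral_prod_symm _ (by exact (hf.mul (hg.comp measurable_snd)).aemeasurable)]
  refine lintegral_congr fun b => ?_
  exact lintegral_mul_const (μ := μ) (g b)
    (show Measurable fun a => f (a, b) from hf.comp measurable_prodMk_right)

/-- Serves to restrict the density to the diagonal `u = v`, where the reference measure is an image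
measure. -/
theorem withDensity_map {α β : Type*} [MeasurableSpace α] [MeasurableSpace β]
    (μ : Measure α) {j : α → β} (hj : Measurable j) {f : β → ℝ≥0∞} (hf : Measurable f) :
    (μ.map j).withDensity f = (μ.withDensity (f ∘ j)).map j := by
  refine Measure.ext_of_lintegral _ fun g hg => ?_
  rw [lintegral_map hg hj, lintegral_withDensity_eq_lintegral_mul _ hf hg,
    lintegral_withDensity_eq_lintegral_mul _ (hf.comp hj)
      (show Measurable fun a => g (j a) from hg.comp hj), lintegral_map (hf.mul hg) hj]
  rfl

variable {V : Type*} [Fintype V] [DecidableEq V] {G : SimpleGraph V} [DecidableRel G.Adj]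

theorem measurable_extendZero {V : Type*} [DecidableEq V] (i₀ : V) :
    Measurable (extendZero i₀) := by
  refine Measurable.subtype_mk (measurable_pi_lambda _ fun i => ?_)
  by_cases h : i = i₀
  · simp [h]
  · simp only [h, dite_false]
    exact measurable_pi_apply _

theorem lintegral_pinnedVolume (i₀ : V) {f : Pinned i₀ → ℝ≥0∞} (hf : Measurable f) :
    ∫⁻ u, f u ∂(pinnedVolume i₀) = ∫⁻ x, f (extendZero i₀ x) :=
  lintegral_map hf (measurable_extendZero i₀)

instance (T₀ : DirectedSpanningTree G) : SFinite (currentVolume T₀) := by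
  unfold currentVolume
  infer_instance

instance (i₀ : V) : SFinite (pinnedVolume i₀) := by
  unfold pinnedVolume
  infer_instance

instance (i₀ : V) : SFinite (diagonalVolume i₀) := by
  unfold diagonalVolume
  infer_instance

instance : MeasurableSingletonClass (SpanningTree G) := ⟨fun _ => trivial⟩

omit [Fintype V] [DecidableEq V] in
theorem continuous_edgeSum (e : Sym2 V) : Continuous fun u : V → ℝ => edgeSum u e := by
  induction e with
  | h k l =>
    simp only [edgeSum, Sym2.lift_mk]
    fun_prop

omit [Fintype V] [DecidableEq V] in
theorem continuous_omega (W : Sym2 V → ℝ) (e : Sym2 V) :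
    Continuous fun u : V → ℝ => omega W u e :=
  continuous_const.mul (Real.continuous_exp.comp (continuous_edgeSum e))

omit [Fintype V] [DecidableEq V] in
theorem continuous_edgeAction (e : Sym2 V) :
    Continuous fun p : (V → ℝ) × (V → ℝ) => edgeAction p.1 p.2 e := by
  induction e with
  | h k l =>
    simp only [edgeAction, Sym2.lift_mk]
    have := Real.continuous_cosh
    fun_prop

omit [DecidableEq V] in
theorem continuous_boltzmann (W : Sym2 V → ℝ) :
    Continuous fun p : (V → ℝ) × (V → ℝ) => boltzmann G W p.1 p.2 :=
  Real.continuous_exp.comp (continuous_finsetSum _ fun e _ =>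
    continuous_const.mul (continuous_edgeAction e))

theorem continuous_rhoSusy (W : Sym2 V → ℝ) (i₀ : V) (T' : SpanningTree G) :
    Continuous fun p : (V → ℝ) × (V → ℝ) => rhoSusy G W i₀ p.1 p.2 T' := by
  unfold rhoSusy
  refine ((continuous_boltzmann W).mul (continuous_finsetProd _ fun e _ => ?_)).mul
    (continuous_finsetProd _ fun i _ => by fun_prop)
  exact continuous_const.mul (Real.continuous_exp.comp
    ((continuous_edgeSum e).comp continuous_snd))

theorem measurable_rhoMarginal (W : Sym2 V → ℝ) (i₀ i₁ i₁' : V) (T T' : SpanningTree G) :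
    Measurable fun p : (V → ℝ) × (V → ℝ) => rhoMarginal G W i₀ p.1 p.2 i₁ i₁' T T' := by
  have hω : ∀ e, Measurable fun p : (V → ℝ) × (V → ℝ) => omega W p.2 e := fun e =>
    ((continuous_omega W e).comp continuous_snd).measurable
  have hp : ∀ S : Finset (Sym2 V), Measurable fun p : (V → ℝ) × (V → ℝ) =>
      ∏ e ∈ S, omega W p.2 e := fun S => Finset.measurable_fun_prod _ fun e _ => hω e
  unfold rhoMarginal
  refine ((((measurable_const.mul (continuous_boltzmann W).measurable).mul (hp _)).mul
    ((hp _).div (Finset.measurable_fun_sum _ fun S _ => hp _))).mul ?_).mul ?_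
  · fun_prop
  · fun_prop

theorem measurable_rhoBig (W : Sym2 V → ℝ) (i₀ i₁ i₁' : V) (T T' : SpanningTree G) :
    Measurable fun p : (G.Dart → ℝ) × (G.Dart → ℝ) × (V → ℝ) × (V → ℝ) × (V → ℝ) =>
      rhoBig G W i₀ p.1 p.2.1 p.2.2.1 p.2.2.2.1 p.2.2.2.2 i₁ i₁' T T' := by
  have hω : ∀ e, Measurable fun p : (G.Dart → ℝ) × (G.Dart → ℝ) × (V → ℝ) × (V → ℝ) × (V → ℝ) =>
      omega W p.2.2.2.2 e := fun e =>
    ((continuous_omega W e).comp (by fun_prop)).measurable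
  have hb : Measurable fun p : (G.Dart → ℝ) × (G.Dart → ℝ) × (V → ℝ) × (V → ℝ) × (V → ℝ) =>
      boltzmann G W p.2.2.1 p.2.2.2.2 :=
    ((continuous_boltzmann W).comp (f := fun p : (G.Dart → ℝ) × (G.Dart → ℝ) × (V → ℝ) ×
      (V → ℝ) × (V → ℝ) => (p.2.2.1, p.2.2.2.2)) (by fun_prop)).measurable
  unfold rhoBig
  refine ((((((measurable_const.mul hb).mul
    (Finset.measurable_fun_prod _ fun e _ => hω e)).mul
    (Finset.measurable_fun_prod _ fun e _ => hω e)).mul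
    (Finset.measurable_fun_prod _ fun e _ => measurable_const.div ((hω e).pow_const 2))).mul
    ?_).mul ?_).mul ?_
  · refine Real.measurable_exp.comp (Measurable.neg (Finset.measurable_fun_sum _ fun d _ => ?_))
    exact Measurable.div (by fun_prop) (measurable_const.mul (hω _))
  · fun_prop
  · fun_prop

omit [Fintype V] [DecidableEq V] [DecidableRel G.Adj] in
theorem omega_pos {W : Sym2 V → ℝ} (hW : ∀ e ∈ G.edgeSet, 0 < W e) (u : V → ℝ) :
    ∀ e ∈ G.edgeSet, 0 < omega W u e := fun e he => by
  have := hW e he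
  have := Real.exp_pos (edgeSum u e)
  unfold omega
  positivity

/-- The sum is the determinant of a positive definite matrix, which also shows that a spanning tree
exists. -/
theorem sum_prod_pos (hG : G.Connected) (ω : Sym2 V → ℝ) (hω : ∀ e ∈ G.edgeSet, 0 < ω e) (i₀ : V) :
    0 < ∑ T : SpanningTree G, ∏ e ∈ T.edges, ω e := by
  rw [← det_reducedLaplacian G ω i₀]
  exact (reducedLaplacian_posDef G hG ω hω i₀).det_pos

/-- Integrating the density of the extended model over the currents. -/
theorem lintegral_rhoBig (hG : G.Connected) {W : Sym2 V → ℝ} (hW : ∀ e ∈ G.edgeSet, 0 < W e)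
    (i₀ : V) (T₀ : DirectedSpanningTree G) (s u : V → ℝ) (i₁ i₁' : V) (T T' : SpanningTree G) :
    ∫⁻ κ' : Currents G, ∫⁻ κ : Currents G,
        ENNReal.ofReal (rhoBig G W i₀ κ κ' s u u i₁ i₁' T T') ∂(currentVolume T₀)
          ∂(currentVolume T₀) =
      ENNReal.ofReal (rhoMarginal G W i₀ s u i₁ i₁' T T') := by
  set ω : Sym2 V → ℝ := omega W u with hωdef
  have hω : ∀ e ∈ G.edgeSet, 0 < ω e := omega_pos hW u
  set n := Fintype.card {i : V // i ≠ i₀} with hn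
  have hn' : Fintype.card V - 1 = n := by
    have := card_ne_add_one i₀
    omega
  set E : Currents G → ℝ := fun κ =>
    Real.exp (-∑ d : G.Dart, (κ : G.Dart → ℝ) d ^ 2 / (2 * ω d.edge)) with hE
  have hE0 : ∀ κ, 0 ≤ E κ := fun κ => (Real.exp_pos _).le
  set Z := ∑ S : SpanningTree G, ∏ e ∈ S.edges, ω e with hZ
  have hZ0 : 0 < Z := sum_prod_pos hG ω hω i₀
  set J := (2 * Real.pi) ^ G.edgeFinset.card * (∏ e ∈ G.edgeFinset, ω e) /
      (√(2 * Real.pi) ^ n * √(2 • reducedLaplacian G ω i₀).det) with hJ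
  have hI : ∫⁻ κ, ENNReal.ofReal (E κ) ∂(currentVolume T₀) = ENNReal.ofReal J :=
    lintegral_exp_currents hG T₀ hω i₀
  have hprod : ∀ S : Finset (Sym2 V), (S : Set (Sym2 V)) ⊆ G.edgeSet → 0 < ∏ e ∈ S, ω e :=
    fun S hS => Finset.prod_pos fun e he => hω e (hS (Finset.mem_coe.2 he))
  have hTp := hprod T.edges T.2.1
  have hT'p := hprod T'.edges T'.2.1
  have hEp := hprod G.edgeFinset (by simp)
  have hdet : (2 • reducedLaplacian G ω i₀).det = 2 ^ n * Z := by
    rw [hZ, ← det_reducedLaplacian G ω i₀, ← Matrix.det_smul, ofNat_smul_eq_nsmul ℝ 2]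
  set K := (4 : ℝ) ^ n / (2 * Real.pi) ^ (2 * G.edgeFinset.card) * boltzmann G W s u
    * (∏ e ∈ T.edges, ω e) * (∏ e ∈ T'.edges, ω e) * (∏ e ∈ G.edgeFinset, 1 / ω e ^ 2)
    * (Real.exp (2 * u i₁ + 2 * u i₁') / (∑ j, Real.exp (2 * u j)) ^ 2)
    * ∏ i : {i : V // i ≠ i₀}, Real.exp (-u i) with hK
  have hB : 0 < boltzmann G W s u := Real.exp_pos _
  have hEi : (∏ e ∈ G.edgeFinset, 1 / ω e ^ 2) = 1 / (∏ e ∈ G.edgeFinset, ω e) ^ 2 := by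
    rw [Finset.prod_div_distrib, Finset.prod_const_one, Finset.prod_pow]
  have hK0 : 0 ≤ K := by
    rw [hK, hEi]
    positivity
  have hrho : ∀ κ κ' : Currents G, rhoBig G W i₀ κ κ' s u u i₁ i₁' T T' = K * E κ' * E κ := by
    intro κ κ'
    have h1 : Real.exp (-∑ d : G.Dart, ((κ : G.Dart → ℝ) d ^ 2 + (κ' : G.Dart → ℝ) d ^ 2) /
        (2 * ω d.edge)) = E κ * E κ' := by
      rw [hE]
      simp only
      rw [← Real.exp_add, ← neg_add, ← Finset.sum_add_distrib]
      simp only [add_div]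
    rw [rhoBig, ← hωdef, h1, hn', hK]
    ring
  simp_rw [hrho]
  have h2 : ∀ κ' : Currents G, ∫⁻ κ : Currents G, ENNReal.ofReal (K * E κ' * E κ)
      ∂(currentVolume T₀) = ENNReal.ofReal K * ENNReal.ofReal J * ENNReal.ofReal (E κ') := by
    intro κ'
    simp_rw [ENNReal.ofReal_mul (mul_nonneg hK0 (hE0 κ')), ENNReal.ofReal_mul hK0]
    rw [lintegral_const_mul' _ _ (ENNReal.mul_ne_top ENNReal.ofReal_ne_top ENNReal.ofReal_ne_top),
      hI]
    ring
  have hJ0 : 0 ≤ J := by rw [hJ]; positivity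
  rw [lintegral_congr h2, lintegral_const_mul' _ _
    (ENNReal.mul_ne_top ENNReal.ofReal_ne_top ENNReal.ofReal_ne_top), hI,
    ← ENNReal.ofReal_mul hK0, ← ENNReal.ofReal_mul (mul_nonneg hK0 hJ0)]
  congr 1
  -- One Gaussian factor comes from `κ` and one from `κ'`; their product contains no square root.
  have hJ2 : J * J = (2 * Real.pi) ^ (2 * G.edgeFinset.card) * (∏ e ∈ G.edgeFinset, ω e) ^ 2 /
      ((2 * Real.pi) ^ n * (2 ^ n * Z)) := by
    have e1 : √(2 * Real.pi) ^ n * √(2 * Real.pi) ^ n = (2 * Real.pi) ^ n := by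
      rw [← mul_pow, Real.mul_self_sqrt (by positivity)]
    have e2 : √(2 ^ n * Z) * √(2 ^ n * Z) = 2 ^ n * Z := Real.mul_self_sqrt (by positivity)
    rw [hJ, hdet, div_mul_div_comm]
    congr 1
    · ring
    · linear_combination √(2 ^ n * Z) ^ 2 * e1 + (2 * Real.pi) ^ n * e2
  rw [mul_assoc, hJ2, hK, hEi, rhoMarginal, hn', ← hωdef, ← hZ]
  -- One factor `2^n` cancels that of `det (2L)`, the other turns `(2π)^n` into `π^n`.
  have e4 : (4 : ℝ) ^ n = 2 ^ n * 2 ^ n := by rw [← mul_pow]; norm_num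
  have hS : 0 < ∑ j, Real.exp (2 * u j) := Finset.sum_pos (fun j _ => Real.exp_pos _) ⟨i₀, by simp⟩
  rw [e4, mul_pow 2 Real.pi n]
  have hEne := hEp.ne'
  have hSne := hS.ne'
  have hZne := hZ0.ne'
  field_simp

/-- The weights of `i₁`, `i₁'` and `T` each sum to 1. The tree `T'` has `|V| - 1` edges, so the
factors 1/2 in its weights turn `π^{|V|-1}` into `(2π)^{|V|-1}`. -/
theorem sum_rhoMarginal (hG : G.Connected) {W : Sym2 V → ℝ} (hW : ∀ e ∈ G.edgeSet, 0 < W e)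
    (i₀ : V) (s u : V → ℝ) (T' : SpanningTree G) :
    ∑ i₁, ∑ i₁', ∑ T, rhoMarginal G W i₀ s u i₁ i₁' T T' = rhoSusy G W i₀ s u T' := by
  have hZ := (sum_prod_pos hG _ (omega_pos hW u) i₀).ne'
  have hS : (∑ j, Real.exp (2 * u j)) ≠ 0 :=
    (Finset.sum_pos (fun j _ => Real.exp_pos _) ⟨i₀, by simp⟩).ne'
  have hn' : Fintype.card V - 1 = Fintype.card {i : V // i ≠ i₀} := by
    have := card_ne_add_one i₀
    omega
  have h1 : ∀ i₁ i₁' T, rhoMarginal G W i₀ s u i₁ i₁' T T' =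
      (1 / Real.pi ^ (Fintype.card V - 1) * boltzmann G W s u * (∏ e ∈ T'.edges, omega W u e) *
        (1 / ∑ S : SpanningTree G, ∏ e ∈ S.edges, omega W u e) *
        (1 / (∑ j, Real.exp (2 * u j)) ^ 2) * ∏ i : {i : V // i ≠ i₀}, Real.exp (-u i)) *
      (Real.exp (2 * u i₁) * (Real.exp (2 * u i₁') * ∏ e ∈ T.edges, omega W u e)) := by
    intro i₁ i₁' T
    rw [rhoMarginal, Real.exp_add]
    ring
  simp_rw [h1, ← Finset.mul_sum, ← Finset.sum_mul]
  have h2 : ∏ e ∈ T'.edges, omega W u e = (1 / 2) ^ Fintype.card {i : V // i ≠ i₀} *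
      ∏ e ∈ T'.edges, W e * Real.exp (edgeSum u e) := by
    have : T'.edges.card = Fintype.card {i : V // i ≠ i₀} := T'.2.card_eq i₀
    rw [← this, ← Finset.prod_const, ← Finset.prod_mul_distrib]
    refine Finset.prod_congr rfl fun e _ => ?_
    rw [omega]
    ring
  rw [rhoSusy, Finset.prod_div_distrib, Finset.prod_const, Finset.card_univ, mul_pow, h2, hn']
  rw [one_div_pow]
  set Z := ∑ S : SpanningTree G, ∏ e ∈ S.edges, omega W u e
  field_simp

end Marginals

/-! ### The two marginals and the normalisation -/

section Main

variable {V : Type*} [Fintype V] [DecidableEq V] {G : SimpleGraph V} [DecidableRel G.Adj]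

/-- Joint measurability when vertices and trees form a countable coordinate `τ`: it is enough to
check the field and current coordinates for each fixed value of it. -/
theorem measurable_ofReal_of_countable {X α β : Type*} [MeasurableSpace X]
    [MeasurableSpace α] [MeasurableSpace β] [Countable β] [MeasurableSingletonClass β]
    (F : α → β → ℝ) (hF : ∀ b, Measurable fun a => F a b) (ρ : X → ℝ) (φ : X → α) (τ : X → β)
    (hφ : Measurable φ) (hτ : Measurable τ) (hρ : ∀ x, ρ x = F (φ x) (τ x)) :
    Measurable fun x => ENNReal.ofReal (ρ x) := by
  have h : Measurable fun p : α × β => F p.1 p.2 := measurable_from_prod_countable_left hF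
  simp only [hρ]
  exact ENNReal.measurable_ofReal.comp (h.comp (hφ.prodMk hτ))

theorem measurable_rhoSusy_pinned (W : Sym2 V → ℝ) (i₀ : V) :
    Measurable fun x : Pinned i₀ × Pinned i₀ × SpanningTree G =>
      ENNReal.ofReal (rhoSusy G W i₀ x.1 x.2.1 x.2.2) :=
  measurable_ofReal_of_countable (fun (p : (V → ℝ) × (V → ℝ)) T' => rhoSusy G W i₀ p.1 p.2 T')
    (fun T' => (continuous_rhoSusy W i₀ T').measurable)
    (fun x : Pinned i₀ × Pinned i₀ × SpanningTree G => rhoSusy G W i₀ x.1 x.2.1 x.2.2)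
    (fun x => (x.1.1, x.2.1.1)) (fun x => x.2.2)
    ((measurable_subtype_coe.comp measurable_fst).prodMk
      (measurable_subtype_coe.comp (measurable_fst.comp measurable_snd))) (by fun_prop) fun _ => rfl

theorem measurable_rhoMarginal_pinned [MeasurableSpace V] [MeasurableSingletonClass V]
    (W : Sym2 V → ℝ) (i₀ : V) :
    Measurable fun x : Pinned i₀ × Pinned i₀ × V × V × SpanningTree G × SpanningTree G =>
      ENNReal.ofReal (rhoMarginal G W i₀ x.1 x.2.1 x.2.2.1 x.2.2.2.1 x.2.2.2.2.1 x.2.2.2.2.2) :=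
  measurable_ofReal_of_countable (fun (p : (V → ℝ) × (V → ℝ))
      (y : V × V × SpanningTree G × SpanningTree G) =>
      rhoMarginal G W i₀ p.1 p.2 y.1 y.2.1 y.2.2.1 y.2.2.2)
    (fun y => measurable_rhoMarginal W i₀ y.1 y.2.1 y.2.2.1 y.2.2.2)
    (fun x : Pinned i₀ × Pinned i₀ × V × V × SpanningTree G × SpanningTree G =>
      rhoMarginal G W i₀ x.1 x.2.1 x.2.2.1 x.2.2.2.1 x.2.2.2.2.1 x.2.2.2.2.2)
    (fun x => (x.1.1, x.2.1.1)) (fun x => x.2.2)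
    ((measurable_subtype_coe.comp measurable_fst).prodMk
      (measurable_subtype_coe.comp (measurable_fst.comp measurable_snd))) (by fun_prop) fun _ => rfl

theorem measurable_rhoBig_pinned [MeasurableSpace V] [MeasurableSingletonClass V]
    (W : Sym2 V → ℝ) (i₀ : V) :
    Measurable fun x : BigSpace G i₀ => ENNReal.ofReal (rhoBig G W i₀ x.1 x.2.1 x.2.2.1
      x.2.2.2.1.1 x.2.2.2.1.2 x.2.2.2.2.1 x.2.2.2.2.2.1 x.2.2.2.2.2.2.1 x.2.2.2.2.2.2.2) :=
  measurable_ofReal_of_countable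
    (fun (p : (G.Dart → ℝ) × (G.Dart → ℝ) × (V → ℝ) × (V → ℝ) × (V → ℝ))
      (y : V × V × SpanningTree G × SpanningTree G) =>
      rhoBig G W i₀ p.1 p.2.1 p.2.2.1 p.2.2.2.1 p.2.2.2.2 y.1 y.2.1 y.2.2.1 y.2.2.2)
    (fun y => measurable_rhoBig W i₀ y.1 y.2.1 y.2.2.1 y.2.2.2)
    (fun x : BigSpace G i₀ => rhoBig G W i₀ x.1 x.2.1 x.2.2.1
      x.2.2.2.1.1 x.2.2.2.1.2 x.2.2.2.2.1 x.2.2.2.2.2.1 x.2.2.2.2.2.2.1 x.2.2.2.2.2.2.2)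
    (fun x => (x.1.1, x.2.1.1, x.2.2.1.1, x.2.2.2.1.1.1, x.2.2.2.1.2.1)) (fun x => x.2.2.2.2)
    ((measurable_subtype_coe.comp measurable_fst).prodMk <|
      (measurable_subtype_coe.comp (measurable_fst.comp measurable_snd)).prodMk <|
      (measurable_subtype_coe.comp (by fun_prop)).prodMk <|
      (measurable_subtype_coe.comp (by fun_prop)).prodMk <|
      measurable_subtype_coe.comp (by fun_prop)) (by fun_prop) fun _ => rfl

theorem _root_.Measurable.of_prodMk_left {α β γ : Type*} [MeasurableSpace α] [MeasurableSpace β]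
    [MeasurableSpace γ] {f : α × β → γ} (hf : Measurable f) (a : α) :
    Measurable fun b => f (a, b) :=
  hf.comp measurable_prodMk_left

theorem _root_.Measurable.of_prodMk_right {α β γ : Type*} [MeasurableSpace α] [MeasurableSpace β]
    [MeasurableSpace γ] {f : α × β → γ} (hf : Measurable f) (b : β) :
    Measurable fun a => f (a, b) :=
  hf.comp measurable_prodMk_right

/-- The marginal of the extended model that is obtained by integrating over the currents. -/
theorem map_muBig [MeasurableSpace V] [MeasurableSingletonClass V] (hG : G.Connected)
    {W : Sym2 V → ℝ} (hW : ∀ e ∈ G.edgeSet, 0 < W e) (i₀ : V) (T₀ : DirectedSpanningTree G) :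
    (muBig W i₀ T₀).map (fun x => (x.2.2.1, x.2.2.2.1.2, x.2.2.2.2)) =
      (marginalVolume G i₀).withDensity fun x => ENNReal.ofReal
        (rhoMarginal G W i₀ x.1 x.2.1 x.2.2.1 x.2.2.2.1 x.2.2.2.2.1 x.2.2.2.2.2) := by
  set C : Measure (V × V × SpanningTree G × SpanningTree G) :=
    Measure.count.prod (Measure.count.prod (Measure.count.prod Measure.count)) with hC
  have : SFinite C := by rw [hC]; infer_instance
  set R : Measure (Pinned i₀ × (Pinned i₀ × Pinned i₀) × V × V × SpanningTree G × SpanningTree G) :=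
    (pinnedVolume i₀).prod ((diagonalVolume i₀).prod C) with hR
  set ρ : BigSpace G i₀ → ℝ≥0∞ := fun x => ENNReal.ofReal (rhoBig G W i₀ x.1 x.2.1 x.2.2.1
    x.2.2.2.1.1 x.2.2.2.1.2 x.2.2.2.2.1 x.2.2.2.2.2.1 x.2.2.2.2.2.2.1 x.2.2.2.2.2.2.2) with hρ
  have hρm : Measurable ρ := measurable_rhoBig_pinned W i₀
  have h0 : muBig W i₀ T₀ =
      ((currentVolume T₀).prod ((currentVolume T₀).prod R)).withDensity ρ := rfl
  have h1 := map_snd_withDensity_prod (currentVolume T₀) ((currentVolume T₀).prod R) hρm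
  have h2 := map_snd_withDensity_prod (currentVolume T₀) R
    (hρm.lintegral_prod_left' (μ := currentVolume T₀))
  set j : Pinned i₀ × Pinned i₀ × V × V × SpanningTree G × SpanningTree G →
      Pinned i₀ × (Pinned i₀ × Pinned i₀) × V × V × SpanningTree G × SpanningTree G :=
    Prod.map id (Prod.map (fun u => (u, u)) id) with hj
  have hjm : Measurable j := by fun_prop
  -- The reference measure lives on the diagonal `v = u`, embedded by `j`; forgetting `v` by `q`
  -- undoes `j`.
  have hRj : R = (marginalVolume G i₀).map j := by
    have hM : marginalVolume G i₀ = (pinnedVolume i₀).prod ((pinnedVolume i₀).prod C) := rfl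
    have hd : Measurable fun u : Pinned i₀ => (u, u) := by fun_prop
    rw [hM, hj, ← Measure.map_prod_map (pinnedVolume i₀) ((pinnedVolume i₀).prod C) measurable_id
      (hd.prodMap measurable_id), ← Measure.map_prod_map (pinnedVolume i₀) C hd measurable_id,
      Measure.map_id, Measure.map_id]
    rfl
  set q : Pinned i₀ × (Pinned i₀ × Pinned i₀) × V × V × SpanningTree G × SpanningTree G →
      Pinned i₀ × Pinned i₀ × V × V × SpanningTree G × SpanningTree G :=
    fun x => (x.1, x.2.1.2, x.2.2) with hq
  have hqm : Measurable q := by fun_prop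
  have hF : (fun x : BigSpace G i₀ => (x.2.2.1, x.2.2.2.1.2, x.2.2.2.2)) =
      q ∘ Prod.snd ∘ Prod.snd := rfl
  rw [h0, hF, ← Measure.map_map hqm (measurable_snd.comp measurable_snd),
    ← Measure.map_map measurable_snd measurable_snd, h1, h2, hRj,
    withDensity_map _ hjm hρm.lintegral_prod_left'.lintegral_prod_left', Measure.map_map hqm hjm]
  have hqj : q ∘ j = id := rfl
  rw [hqj, Measure.map_id]
  congr 1
  funext x
  exact lintegral_rhoBig hG hW i₀ T₀ x.1 x.2.1 x.2.2.1 x.2.2.2.1 x.2.2.2.2.1 x.2.2.2.2.2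

theorem rhoMarginal_nonneg {W : Sym2 V → ℝ} (hW : ∀ e ∈ G.edgeSet, 0 < W e) (i₀ : V)
    (s u : V → ℝ) (i₁ i₁' : V) (T T' : SpanningTree G) :
    0 ≤ rhoMarginal G W i₀ s u i₁ i₁' T T' := by
  have hprod : ∀ S : SpanningTree G, 0 ≤ ∏ e ∈ S.edges, omega W u e :=
    fun S => Finset.prod_nonneg fun e he => (omega_pos hW u e (S.2.1 (Finset.mem_coe.2 he))).le
  have h1 := hprod T
  have h2 := hprod T'
  have h3 := Finset.sum_nonneg fun S (_ : S ∈ Finset.univ) => hprod S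
  have h4 : 0 ≤ boltzmann G W s u := (Real.exp_pos _).le
  have := Real.pi_pos
  unfold rhoMarginal
  positivity

/-- The marginal of `(s, u, T')`. -/
theorem map_withDensity_rhoMarginal [MeasurableSpace V] [MeasurableSingletonClass V]
    (hG : G.Connected) {W : Sym2 V → ℝ} (hW : ∀ e ∈ G.edgeSet, 0 < W e) (i₀ : V) :
    ((marginalVolume G i₀).withDensity fun x => ENNReal.ofReal
        (rhoMarginal G W i₀ x.1 x.2.1 x.2.2.1 x.2.2.2.1 x.2.2.2.2.1 x.2.2.2.2.2)).map
      (fun x => (x.1, x.2.1, x.2.2.2.2.2)) = muSusy G W i₀ := by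
  refine Measure.ext_of_lintegral _ fun g hg => ?_
  have hm := measurable_rhoMarginal_pinned (G := G) W i₀
  have hgr : Measurable fun x : Pinned i₀ × Pinned i₀ × V × V × SpanningTree G × SpanningTree G =>
      g (x.1, x.2.1, x.2.2.2.2.2) := hg.comp (by fun_prop)
  have hs := measurable_rhoSusy_pinned (G := G) W i₀
  have hmg := hm.mul hgr
  rw [lintegral_map hg (by fun_prop), lintegral_withDensity_eq_lintegral_mul _ hm hgr, muSusy,
    lintegral_withDensity_eq_lintegral_mul _ hs hg, marginalVolume,
    lintegral_prod _ hmg.aemeasurable, lintegral_prod _ (hs.mul hg).aemeasurable]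
  refine lintegral_congr fun s => ?_
  have hms := hmg.of_prodMk_left s
  have hss := (hs.mul hg).of_prodMk_left s
  rw [lintegral_prod _ hms.aemeasurable, lintegral_prod _ hss.aemeasurable]
  refine lintegral_congr fun u => ?_
  have hmu := hms.of_prodMk_left u
  rw [lintegral_prod _ hmu.aemeasurable, lintegral_count, lintegral_count, tsum_fintype,
    tsum_fintype]
  have h1 : ∀ i₁ : V, ∫⁻ y : V × SpanningTree G × SpanningTree G,
      ((fun x : Pinned i₀ × Pinned i₀ × V × V × SpanningTree G × SpanningTree G =>
        ENNReal.ofReal (rhoMarginal G W i₀ x.1 x.2.1 x.2.2.1 x.2.2.2.1 x.2.2.2.2.1 x.2.2.2.2.2)) *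
        fun x : Pinned i₀ × Pinned i₀ × V × V × SpanningTree G × SpanningTree G =>
          g (x.1, x.2.1, x.2.2.2.2.2)) (s, u, i₁, y)
        ∂(Measure.count.prod (Measure.count.prod Measure.count)) =
      ∑ i₁', ∑ T, ∑ T', ENNReal.ofReal (rhoMarginal G W i₀ s u i₁ i₁' T T') * g (s, u, T') := by
    intro i₁
    rw [lintegral_prod _ (hmu.of_prodMk_left i₁).aemeasurable, lintegral_count,
      tsum_fintype]
    refine Finset.sum_congr rfl fun i₁' _ => ?_
    rw [lintegral_prod _ ((hmu.of_prodMk_left i₁).of_prodMk_left i₁').aemeasurable, lintegral_count,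
      tsum_fintype]
    refine Finset.sum_congr rfl fun T _ => ?_
    rw [lintegral_count, tsum_fintype]
    rfl
  rw [Finset.sum_congr rfl fun i₁ _ => h1 i₁]
  have h2 : ∀ T', ENNReal.ofReal (rhoSusy G W i₀ s u T') =
      ∑ i₁, ∑ i₁', ∑ T, ENNReal.ofReal (rhoMarginal G W i₀ s u i₁ i₁' T T') := by
    intro T'
    have hnn := fun i₁ i₁' T => rhoMarginal_nonneg hW i₀ s u i₁ i₁' T T'
    rw [← sum_rhoMarginal hG hW, ENNReal.ofReal_sum_of_nonneg fun i₁ _ =>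
      Finset.sum_nonneg fun i₁' _ => Finset.sum_nonneg fun T _ => hnn i₁ i₁' T]
    refine Finset.sum_congr rfl fun i₁ _ => ?_
    rw [ENNReal.ofReal_sum_of_nonneg fun i₁' _ => Finset.sum_nonneg fun T _ => hnn i₁ i₁' T]
    refine Finset.sum_congr rfl fun i₁' _ => ?_
    rw [ENNReal.ofReal_sum_of_nonneg fun T _ => hnn i₁ i₁' T]
  simp only [Pi.mul_apply, h2, Finset.sum_mul]
  rw [Finset.sum_comm (s := (Finset.univ : Finset (SpanningTree G)))]
  refine Finset.sum_congr rfl fun i₁ _ => ?_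
  rw [Finset.sum_comm (s := (Finset.univ : Finset (SpanningTree G)))]
  refine Finset.sum_congr rfl fun i₁' _ => ?_
  rw [Finset.sum_comm (s := (Finset.univ : Finset (SpanningTree G)))]

/-- Given `u`, the field `s` is Gaussian with precision matrix the reduced Laplacian with weights
`W_ij e^{u_i + u_j}`. -/
theorem boltzmann_eq_mul (W : Sym2 V → ℝ) {i₀ : V} (s : V → ℝ) (hs : s i₀ = 0) (u : V → ℝ) :
    boltzmann G W s u = boltzmann G W 0 u * Real.exp
      (-((fun j : {j : V // j ≠ i₀} => s j) ⬝ᵥ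
        (reducedLaplacian G (fun e => W e * Real.exp (edgeSum u e)) i₀).mulVec fun j => s j) / 2)
      := by
  rw [reducedLaplacian_quadratic _ _ _ s hs, boltzmann, boltzmann, ← Real.exp_add]
  congr 1
  rw [← Finset.sum_neg_distrib, Finset.sum_div, ← Finset.sum_add_distrib]
  refine Finset.sum_congr rfl fun e _ => ?_
  induction e with
  | h k l =>
    rw [sq_sub_out_edge]
    simp only [edgeAction, edgeSum, Sym2.lift_mk, Pi.zero_apply]
    ring

/-- The tree version of the `H^{2|2}` model is normalized. -/
theorem muSusy_univ (hG : G.Connected) {W : Sym2 V → ℝ} (hW : ∀ e ∈ G.edgeSet, 0 < W e) (i₀ : V) :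
    muSusy G W i₀ Set.univ = 1 := by
  have hs := measurable_rhoSusy_pinned (G := G) W i₀
  rw [muSusy, withDensity_apply _ MeasurableSet.univ, Measure.restrict_univ,
    lintegral_prod _ hs.aemeasurable]
  have h1 : ∀ s : Pinned i₀, ∫⁻ y : Pinned i₀ × SpanningTree G,
      ENNReal.ofReal (rhoSusy G W i₀ s y.1 y.2) ∂((pinnedVolume i₀).prod Measure.count) =
      ∫⁻ u : Pinned i₀, ∑ T', ENNReal.ofReal (rhoSusy G W i₀ s u T') ∂(pinnedVolume i₀) := by
    intro s
    rw [lintegral_prod _ (hs.of_prodMk_left s).aemeasurable]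
    refine lintegral_congr fun u => ?_
    rw [lintegral_count, tsum_fintype]
  have hsum : Measurable fun p : Pinned i₀ × Pinned i₀ =>
      ∑ T', ENNReal.ofReal (rhoSusy G W i₀ p.1 p.2 T') :=
    Finset.measurable_fun_sum _ fun T' _ => hs.comp
      (f := fun p : Pinned i₀ × Pinned i₀ => (p.1, p.2, T')) (by fun_prop)
  -- Exchange the integrals so that `s` is integrated out at fixed `u`.
  rw [lintegral_congr h1, lintegral_lintegral_swap hsum.aemeasurable,
    lintegral_pinnedVolume i₀ hsum.lintegral_prod_left']
  set n := Fintype.card {i : V // i ≠ i₀} with hn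
  have h2 : ∀ x : {i : V // i ≠ i₀} → ℝ,
      ∫⁻ s : Pinned i₀, ∑ T', ENNReal.ofReal (rhoSusy G W i₀ s (extendZero i₀ x : V → ℝ) T')
        ∂(pinnedVolume i₀) =
      ENNReal.ofReal (1 / √(2 * Real.pi) ^ n) *
        ENNReal.ofReal (boltzmann G W 0 (extendZero i₀ x : V → ℝ) *
          √(reducedLaplacian G
            (fun e => W e * Real.exp (edgeSum (extendZero i₀ x : V → ℝ) e)) i₀).det *
          Real.exp (-∑ i, x i)) := by
    intro x
    rw [lintegral_pinnedVolume i₀ (hsum.of_prodMk_right (extendZero i₀ x))]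
    set u : V → ℝ := (extendZero i₀ x : V → ℝ) with hu
    set ω : Sym2 V → ℝ := fun e => W e * Real.exp (edgeSum u e) with hω
    have hω0 : ∀ e ∈ G.edgeSet, 0 < ω e := fun e he => mul_pos (hW e he) (Real.exp_pos _)
    set L := reducedLaplacian G ω i₀ with hL
    have hLp : L.PosDef := reducedLaplacian_posDef G hG ω hω0 i₀
    have hd := hLp.det_pos
    have hb : 0 < boltzmann G W 0 u := Real.exp_pos _
    -- The sum over `T'` is `det L` by the matrix-tree theorem; the Gaussian integral over `s` then
    -- divides it by its square root.
    have h3 : ∀ y : {i : V // i ≠ i₀} → ℝ,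
        ∑ T', ENNReal.ofReal (rhoSusy G W i₀ (extendZero i₀ y : V → ℝ) u T') =
        ENNReal.ofReal (boltzmann G W 0 u * L.det * (Real.exp (-∑ i, x i) / (2 * Real.pi) ^ n)) *
          ENNReal.ofReal (Real.exp (-(y ⬝ᵥ L.mulVec y) / 2)) := by
      intro y
      rw [← ENNReal.ofReal_sum_of_nonneg]
      · rw [← ENNReal.ofReal_mul (by positivity)]
        congr 1
        simp only [rhoSusy, ← Finset.sum_mul, ← Finset.mul_sum]
        rw [← det_reducedLaplacian G ω i₀, ← hL, boltzmann_eq_mul W _ (extendZero_self i₀ y),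
          Finset.prod_div_distrib, Finset.prod_const, Finset.card_univ, ← hn, ← Real.exp_sum]
        simp only [extendZero_coe, hu, Finset.sum_neg_distrib]
        ring
      · intro T' _
        unfold rhoSusy
        refine mul_nonneg (mul_nonneg (Real.exp_pos _).le (Finset.prod_nonneg fun e he =>
          (hω0 e (T'.2.1 (Finset.mem_coe.2 he))).le)) (by positivity)
    rw [lintegral_congr h3, lintegral_const_mul' _ _ ENNReal.ofReal_ne_top,
      lintegral_exp_neg_quadratic L hLp, ← hn, ← ENNReal.ofReal_mul (by positivity),
      ← ENNReal.ofReal_mul (by positivity)]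
    congr 1
    have e1 : √(2 * Real.pi) ^ n * √(2 * Real.pi) ^ n = (2 * Real.pi) ^ n := by
      rw [← mul_pow, Real.mul_self_sqrt (by positivity)]
    have e2 : √L.det * √L.det = L.det := Real.mul_self_sqrt hd.le
    have e3 : √L.det ≠ 0 := (Real.sqrt_pos.2 hd).ne'
    have e4 : √(2 * Real.pi) ^ n ≠ 0 := by positivity
    rw [← e1]
    nth_rw 1 [← e2]
    field_simp
  have hpos : 0 < √(2 * Real.pi) ^ n := by positivity
  rw [lintegral_congr h2, lintegral_const_mul' _ _ ENNReal.ofReal_ne_top,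
    lintegral_boltzmann_mul_sqrt_det G W i₀ hG hW, ← hn, ← ENNReal.ofReal_mul (by positivity),
    one_div_mul_cancel hpos.ne', ENNReal.ofReal_one]

end Main

end ExtendedH22

theorem mainTheorem4 {V : Type*} [Fintype V] [DecidableEq V]
    [MeasurableSpace V] [MeasurableSingletonClass V]
    (G : SimpleGraph V) [DecidableRel G.Adj] (hG : G.Connected)
    (W : Sym2 V → ℝ) (hW : ∀ e ∈ G.edgeSet, 0 < W e) (i₀ : V)
    (T₀ : ExtendedH22.DirectedSpanningTree G) :
    (ExtendedH22.muBig W i₀ T₀).map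
        (fun ⟨_, _, s, (_, u), i₁, i₁', T, T'⟩ => (s, u, i₁, i₁', T, T'))
      = (ExtendedH22.marginalVolume G i₀).withDensity
          (fun ⟨s, u, i₁, i₁', T, T'⟩ =>
            ENNReal.ofReal (ExtendedH22.rhoMarginal G W i₀ s u i₁ i₁' T T'))
    ∧ (ExtendedH22.muBig W i₀ T₀).map
        (fun ⟨_, _, s, (_, u), _, _, _, T'⟩ => (s, u, T'))
      = ExtendedH22.muSusy G W i₀
    ∧ IsProbabilityMeasure (ExtendedH22.muBig W i₀ T₀) := by
  have h1 := ExtendedH22.map_muBig hG hW i₀ T₀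
  have h2 : (ExtendedH22.muBig W i₀ T₀).map (fun x => (x.2.2.1, x.2.2.2.1.2, x.2.2.2.2.2.2.2)) =
      ExtendedH22.muSusy G W i₀ := by
    rw [← ExtendedH22.map_withDensity_rhoMarginal hG hW i₀, ← h1,
      Measure.map_map (by fun_prop) (by fun_prop)]
    rfl
  refine ⟨h1, h2, ⟨?_⟩⟩
  -- Passing to a marginal preserves the total mass.
  rw [← ExtendedH22.muSusy_univ hG hW i₀, ← h2, Measure.map_apply (by fun_prop) MeasurableSet.univ,
    Set.preimage_univ]
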